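/- A weighted graph is a finite simple graph $G$ in which every edge $e$ is assigned a non-negative real number $w(e)$. The weight $w(P)$ of a path $P$ is the sum of the weights of its edges, and the weighted degree of a vertex $v$ is $d^w(v)=\sum_{u\in N(v)}w(vu)$, where $N(v)$ is the set of neighbours of $v$. An $x$-path is a path whose initial vertex is $x$ (possibly the single vertex $x$), and an $(x,y)$-path is a path with end-vertices $x$ and $y$. Paths are called disjoint if they have no vertex in common. A graph is 2-connected if it has at least three vertices, is connected, and remains connected after the deletion of any one vertex. \textbf{Theorem 10.} Let $G$ be a 2-connected weighted graph, let $x$ and $y$ be two distinct vertices of $G$, and let $d$ be a real number. Suppose that $$\max\{d^w(v_1),d^w(v_2),d^w(v_3)\}\ge d$$ for every three distinct pairwise nonadjacent vertices $v_1,v_2,v_3\in V(G)\setminus\{x,y\}$. Then at least one of the following holds: (1) $G$ contains an $(x,y)$-path $P$ with $w(P)\ge d$; (2) $G$ contains an $x$-path $P_1$ and a $y$-path $P_2$ which are disjoint and satisfy $w(P_1)+w(P_2)\ge d$; (3) $G$ contains an $x$-path $P_1$ and a $y$-path $P_2$ which are disjoint and satisfy $V(G)=V(P_1)\cup V(P_2)$.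 -/

import Mathlib

namespace WGraph

/-- A graph is 2-connected: it has at least three vertices, it is connected, and it remains
connected after the deletion of any single vertex. -/
structure IsTwoConnected {V : Type*} [Fintype V] (G : SimpleGraph V) : Prop where
  three_le_card : 3 ≤ Fintype.card V
  connected : G.Connected
  connected_delete : ∀ v : V, (G.induce {u : V | u ≠ v}).Connected

open Classical in
/-- The weighted degree of `v` in `G`: the sum of `w(vu)` over the neighbours `u` of `v`. -/
noncomputable def weightedDegree {V : Type*} [Fintype V] (G : SimpleGraph V)
    (w : Sym2 V → ℝ) (v : V) : ℝ :=
  ∑ u ∈ Finset.univ.filter (fun u : V => G.Adj v u), w s(v, u)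

/-- The sum of the weights of the edges of a walk, in order; a path repeats no edge, so for a
path this is the weight of the path as a subgraph. -/
def walkWeight {V : Type*} {G : SimpleGraph V} (w : Sym2 V → ℝ) {u v : V}
    (p : G.Walk u v) : ℝ :=
  (p.edges.map w).sum

end WGraph

namespace WGraph

variable {V : Type*}

/-- The weight of a list of vertices: the sum of `w` over consecutive pairs. -/
def listWeight (w : V → V → ℝ) : List V → ℝ
  | [] => 0
  | [_] => 0
  | a :: b :: l => w a b + listWeight w (b :: l)

/-- `w` is a symmetric non-negative weight function that vanishes off the edges of `G`. -/
structure IsWeight (G : SimpleGraph V) (w : V → V → ℝ) : Prop where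
  symm : ∀ u v, w u v = w v u
  nonneg : ∀ u v, 0 ≤ w u v
  eq_zero : ∀ u v, ¬ G.Adj u v → w u v = 0

/-- `l` lists the vertices of a path of `G` inside `S` with initial vertex `x`. -/
structure IsPathFrom (G : SimpleGraph V) (S : Finset V) (x : V) (l : List V) : Prop where
  chain : l.IsChain G.Adj
  nodup : l.Nodup
  subset : ∀ v ∈ l, v ∈ S
  head : l.head? = some x

section ListWeight

variable (w : V → V → ℝ)

@[simp] lemma listWeight_nil : listWeight w [] = 0 := rfl

@[simp] lemma listWeight_singleton (a : V) : listWeight w [a] = 0 := rfl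

@[simp] lemma listWeight_cons_cons (a b : V) (l : List V) :
    listWeight w (a :: b :: l) = w a b + listWeight w (b :: l) := rfl

lemma listWeight_cons {l : List V} {v : V} (h : l.head? = some v) (a : V) :
    listWeight w (a :: l) = w a v + listWeight w l := by
  cases l with
  | nil => simp at h
  | cons b l => simp at h; subst h; rfl

lemma listWeight_append {l m : List V} {u v : V} (hl : l.getLast? = some u)
    (hm : m.head? = some v) :
    listWeight w (l ++ m) = listWeight w l + w u v + listWeight w m := by
  induction l with
  | nil => simp at hl
  | cons a l ih =>
    cases l with
    | nil =>
      simp at hl; subst hl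
      simpa using listWeight_cons w hm a
    | cons b l =>
      have := ih (by simpa using hl)
      simp only [List.cons_append, listWeight_cons_cons] at this ⊢
      linarith

lemma listWeight_reverse (hw : ∀ u v, w u v = w v u) (l : List V) :
    listWeight w l.reverse = listWeight w l := by
  induction l with
  | nil => rfl
  | cons a l ih =>
    cases l with
    | nil => rfl
    | cons b l =>
      rw [List.reverse_cons, listWeight_append w (u := b) (v := a) (by simp) rfl, ih]
      simp [hw a b]; ring

variable {w} in
lemma listWeight_nonneg (hw : ∀ u v, 0 ≤ w u v) (l : List V) : 0 ≤ listWeight w l := by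
  induction l with
  | nil => simp
  | cons a l ih =>
    cases l with
    | nil => simp
    | cons b l => simpa using add_nonneg (hw a b) ih

variable {w} in
/-- A sum over the edges of a list is bounded by its weight when every edge is. -/
lemma sum_dropLast_add_sum_tail_le (f g : V → ℝ) (l : List V)
    (h : ∀ s t a b, l = s ++ a :: b :: t → f a + g b ≤ w a b) :
    (l.dropLast.map f).sum + (l.tail.map g).sum ≤ listWeight w l := by
  induction l with
  | nil => simp
  | cons a l ih =>
    cases l with
    | nil => simp
    | cons b l =>
      have h1 := h [] l a b rfl
      have h2 := ih (fun s t c e hs => h (a :: s) t c e (by simp [hs]))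
      simp only [List.dropLast_cons_cons, List.map_cons, List.sum_cons, List.tail_cons,
        listWeight_cons_cons] at h2 ⊢
      linarith

lemma exists_not_rel_of_not_isChain {R : V → V → Prop} {l : List V} (h : ¬ l.IsChain R) :
    ∃ s t a b, l = s ++ a :: b :: t ∧ ¬ R a b := by
  rw [List.isChain_iff_forall_rel_of_append_cons_cons] at h
  push Not at h
  obtain ⟨a, b, s, t, h1, h2⟩ := h
  exact ⟨s, t, a, b, h1, h2⟩

end ListWeight

namespace IsPathFrom

variable {G : SimpleGraph V} {S T U : Finset V} {x y z u : V} {l m : List V}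

lemma mono (h : IsPathFrom G S x l) (hST : ∀ v ∈ l, v ∈ T) : IsPathFrom G T x l :=
  ⟨h.chain, h.nodup, hST, h.head⟩

lemma head_mem (h : IsPathFrom G S x l) : x ∈ l := List.mem_of_head? h.head

lemma singleton (hx : x ∈ S) : IsPathFrom G S x [x] :=
  ⟨by simp, by simp, by simpa, rfl⟩

lemma append (h : IsPathFrom G S x l) (hm : IsPathFrom G T z m) (hl : l.getLast? = some u)
    (huz : G.Adj u z) (hd : ∀ v ∈ l, v ∉ m) (hS : ∀ v ∈ S, v ∈ U) (hT : ∀ v ∈ T, v ∈ U) :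
    IsPathFrom G U x (l ++ m) where
  chain := by
    rw [List.isChain_append]
    refine ⟨h.chain, hm.chain, ?_⟩
    intro a ha b hb
    rw [hl] at ha; rw [hm.head] at hb
    simp at ha hb; subst ha; subst hb; exact huz
  nodup := by
    rw [List.nodup_append]
    exact ⟨h.nodup, hm.nodup, fun a ha b hb hab => hd a ha (hab ▸ hb)⟩
  subset v hv := by
    rcases List.mem_append.1 hv with hv | hv
    · exact hS v (h.subset v hv)
    · exact hT v (hm.subset v hv)
  head := by rw [List.head?_append, h.head]; rfl

lemma cons (hm : IsPathFrom G T z m) (hxz : G.Adj x z) (hxm : x ∉ m) (hx : x ∈ U)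
    (hT : ∀ v ∈ m, v ∈ U) : IsPathFrom G U x (x :: m) where
  chain := by
    rw [List.isChain_cons]
    refine ⟨fun b hb => ?_, hm.chain⟩
    rw [hm.head] at hb; simp at hb; subst hb; exact hxz
  nodup := by simpa using ⟨hxm, hm.nodup⟩
  subset v hv := by
    rcases List.mem_cons.1 hv with rfl | hv
    · exact hx
    · exact hT v hv
  head := rfl

lemma reverse (h : IsPathFrom G S x l) (hl : l.getLast? = some y) :
    IsPathFrom G S y l.reverse where
  chain := by
    rw [List.isChain_reverse]; exact h.chain.imp fun _ _ hab => SimpleGraph.Adj.symm hab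
  nodup := by simpa using h.nodup
  subset v hv := h.subset v (by simpa using hv)
  head := by simpa using hl

lemma getLast?_reverse (h : IsPathFrom G S x l) : l.reverse.getLast? = some x := by
  simpa using h.head

lemma ne_nil (h : IsPathFrom G S x l) : l ≠ [] := by
  rintro rfl; simpa using h.head

lemma exists_getLast? (h : IsPathFrom G S x l) : ∃ y, l.getLast? = some y :=
  ⟨l.getLast h.ne_nil, List.getLast?_eq_some_getLast h.ne_nil⟩

/-- A path may be extended by any further vertex, without loss when the extension is missing. -/
lemma exists_extend {w : V → V → ℝ} (hw : IsWeight G w) (h : IsPathFrom G S x l)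
    (hl : l.getLast? = some u) (hz : z ∉ l) (hzS : z ∈ S) :
    ∃ l', IsPathFrom G S x l' ∧ (∀ v ∈ l', v ∈ l ∨ v = z) ∧
      listWeight w l' = listWeight w l + w u z := by
  by_cases huz : G.Adj u z
  · refine ⟨l ++ [z], h.append (singleton hzS) hl huz ?_ (fun _ h => h) (fun _ h => h), ?_, ?_⟩
    · intro v hv; simp; rintro rfl; exact hz hv
    · intro v hv; simpa using hv
    · rw [listWeight_append w hl (v := z) rfl]; simp
  · exact ⟨l, h, fun v hv => Or.inl hv, by rw [hw.eq_zero u z huz]; ring⟩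

end IsPathFrom

end WGraph

namespace WGraph

variable {V : Type*}

/-- Every nonempty set of vertices of `S` avoiding the terminals `x` and `y` has at least two
neighbours in `S`; that is, `G[S]` becomes 2-connected once the edge `xy` is added. -/
structure Linked (G : SimpleGraph V) (S : Finset V) (x y : V) : Prop where
  left_mem : x ∈ S
  right_mem : y ∈ S
  ne : x ≠ y
  expand : ∀ X ⊆ S, X.Nonempty → x ∉ X → y ∉ X → ∀ c, ∃ v ∈ X, ∃ u ∈ S, u ∉ X ∧ u ≠ c ∧ G.Adj v u

/-- The set `A` avoids `x` and `y`, and its only neighbours in `S` are `x` and `a`. -/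
structure IsCut (G : SimpleGraph V) (S : Finset V) (x y a : V) (A : Finset V) : Prop where
  subset : A ⊆ S
  nonempty : A.Nonempty
  left_notMem : x ∉ A
  right_notMem : y ∉ A
  mem : a ∈ S
  ne : a ≠ x
  notMem : a ∉ A
  closed : ∀ v ∈ A, ∀ u ∈ S, u ∉ A → G.Adj v u → u = x ∨ u = a

/-- The weighted degree of `v` into `S`. -/
def degreeIn (w : V → V → ℝ) (S : Finset V) (v : V) : ℝ := ∑ u ∈ S, w v u

/-- There is an `(x, y)`-path in `S` of weight at least `d`. -/
def HeavyPath (G : SimpleGraph V) (w : V → V → ℝ) (S : Finset V) (x y : V) (d : ℝ) : Prop :=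
  ∃ l, IsPathFrom G S x l ∧ l.getLast? = some y ∧ d ≤ listWeight w l

/-- There is a Hamiltonian `(x, y)`-path of `S`. -/
def HamPath (G : SimpleGraph V) (S : Finset V) (x y : V) : Prop :=
  ∃ l, IsPathFrom G S x l ∧ l.getLast? = some y ∧ ∀ v ∈ S, v ∈ l

variable {G : SimpleGraph V} {w : V → V → ℝ} {S T : Finset V} {x y z a b : V} {d : ℝ}
  {A : Finset V}

lemma Linked.symm (h : Linked G S x y) : Linked G S y x :=
  ⟨h.right_mem, h.left_mem, h.ne.symm, fun X hX hne hy hx c => h.expand X hX hne hx hy c⟩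

lemma HeavyPath.symm (hw : IsWeight G w) (h : HeavyPath G w S x y d) : HeavyPath G w S y x d := by
  obtain ⟨l, hl, hly, hd⟩ := h
  exact ⟨l.reverse, hl.reverse hly, hl.getLast?_reverse, by rwa [listWeight_reverse w hw.symm]⟩

lemma HamPath.symm (h : HamPath G S x y) : HamPath G S y x := by
  obtain ⟨l, hl, hly, hd⟩ := h
  exact ⟨l.reverse, hl.reverse hly, hl.getLast?_reverse, by simpa using hd⟩

lemma IsCut.swap (hL : Linked G S x y) (h : IsCut G S x y y A) : IsCut G S y x x A :=
  ⟨h.subset, h.nonempty, h.right_notMem, h.left_notMem, hL.left_mem, hL.ne, h.left_notMem,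
    fun v hv u hu h1 h2 => (h.closed v hv u hu h1 h2).symm⟩

lemma IsCut.exists_adj_right (hL : Linked G S x y) (h : IsCut G S x y a A) : ∃ v ∈ A, G.Adj v a := by
  obtain ⟨v, hv, u, hu, huA, hua, hvu⟩ :=
    hL.expand A h.subset h.nonempty h.left_notMem h.right_notMem x
  obtain rfl | rfl := h.closed v hv u hu huA hvu
  · exact absurd rfl hua
  · exact ⟨v, hv, hvu⟩

variable [DecidableEq V]

lemma HeavyPath.cons (hxz : G.Adj x z) (hx : x ∈ S)
    (h : HeavyPath G w (S.erase x) z y (d - w x z)) : HeavyPath G w S x y d := by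
  obtain ⟨l, hl, hly, hd⟩ := h
  refine ⟨x :: l, hl.cons hxz (fun hh => by simpa using hl.subset x hh) hx
    (fun v hv => Finset.mem_of_mem_erase (hl.subset v hv)), ?_, ?_⟩
  · rw [List.getLast?_cons, hly]; rfl
  · rw [listWeight_cons w hl.head]; linarith

lemma HamPath.cons (hxz : G.Adj x z) (hx : x ∈ S)
    (h : HamPath G (S.erase x) z y) : HamPath G S x y := by
  obtain ⟨l, hl, hly, hd⟩ := h
  refine ⟨x :: l, hl.cons hxz (fun hh => by simpa using hl.subset x hh) hx
    (fun v hv => Finset.mem_of_mem_erase (hl.subset v hv)), ?_, fun v hv => ?_⟩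
  · rw [List.getLast?_cons, hly]; rfl
  · by_cases hvx : v = x
    · simp [hvx]
    · exact List.mem_cons_of_mem _ (hd v (Finset.mem_erase.2 ⟨hvx, hv⟩))

/-- If no set separates `z` from `y` in `T`, then `T` contains a `(z, y)`-path. -/
lemma exists_path_of_expand (hz : z ∈ T)
    (h : ∀ C ⊆ T, z ∈ C → y ∉ C → ∃ v ∈ C, ∃ u ∈ T, u ∉ C ∧ G.Adj v u) :
    ∃ l, IsPathFrom G T z l ∧ l.getLast? = some y := by
  classical
  let C := T.filter (fun v => ∃ p : G.Walk z v, ∀ u ∈ p.support, u ∈ T)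
  have hzC : z ∈ C := Finset.mem_filter.2 ⟨hz, .nil, by simpa⟩
  by_cases hy : y ∈ C
  · obtain ⟨-, p, hp⟩ := Finset.mem_filter.1 hy
    refine ⟨p.bypass.support, ⟨p.bypass.isChain_adj_support, (p.bypass_isPath).support_nodup,
      fun v hv => hp v (p.support_bypass_subset_support hv), ?_⟩, ?_⟩
    · rw [List.head?_eq_some_head p.bypass.support_ne_nil]; simp
    · rw [List.getLast?_eq_some_getLast p.bypass.support_ne_nil]; simp
  · obtain ⟨v, hv, u, hu, huC, hvu⟩ := h C (Finset.filter_subset _ _) hzC hy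
    obtain ⟨-, p, hp⟩ := Finset.mem_filter.1 hv
    refine absurd (Finset.mem_filter.2 ⟨hu, p.append (.cons hvu .nil), fun t ht => ?_⟩) huC
    rw [SimpleGraph.Walk.mem_support_append_iff] at ht
    rcases ht with ht | ht
    · exact hp t ht
    · simp at ht
      rcases ht with rfl | rfl
      · exact hp _ (by simp)
      · exact hu

namespace IsCut

lemma side_subset (hL : Linked G S x y) (h : IsCut G S x y a A) : insert x (insert a A) ⊆ S :=
  Finset.insert_subset hL.left_mem (Finset.insert_subset h.mem h.subset)

lemma linked (hL : Linked G S x y) (h : IsCut G S x y a A) :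
    Linked G (insert x (insert a A)) x a where
  left_mem := by simp
  right_mem := by simp
  ne := h.ne.symm
  expand X hX hne hx ha c := by
    have hXA : X ⊆ A := fun v hv => by
      have := hX hv
      simp only [Finset.mem_insert] at this
      rcases this with rfl | rfl | h
      · exact absurd hv hx
      · exact absurd hv ha
      · exact h
    obtain ⟨v, hv, u, hu, huX, huc, hvu⟩ :=
      hL.expand X (hXA.trans h.subset) hne hx (fun hy => h.right_notMem (hXA hy)) c
    refine ⟨v, hv, u, ?_, huX, huc, hvu⟩
    by_cases huA : u ∈ A
    · simp [huA]
    · rcases h.closed v (hXA hv) u hu huA hvu with rfl | rfl <;> simp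

lemma degreeIn_eq (hw : IsWeight G w) (hL : Linked G S x y) (h : IsCut G S x y a A)
    {v : V} (hv : v ∈ A) : degreeIn w (insert x (insert a A)) v = degreeIn w S v := by
  refine Finset.sum_subset (h.side_subset hL) fun u hu hun => hw.eq_zero _ _ fun hvu => hun ?_
  by_cases huA : u ∈ A
  · simp [huA]
  · rcases h.closed v hv u hu huA hvu with rfl | rfl <;> simp

/-- A path from `a` to `y` off `A` and `x`. -/
lemma exists_path (hL : Linked G S x y) (h : IsCut G S x y a A) :
    ∃ l, IsPathFrom G (S \ insert x A) a l ∧ l.getLast? = some y := by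
  refine exists_path_of_expand (by simp [h.mem, h.ne, h.notMem]) fun C hC haC hyC => ?_
  have hC' : ∀ v ∈ C, v ∈ S ∧ v ≠ x ∧ v ∉ A := fun v hv => by simpa using hC hv
  obtain ⟨v, hv, u, hu, huX, huc, hvu⟩ := hL.expand (A ∪ C)
    (Finset.union_subset h.subset fun v hv => (hC' v hv).1) ⟨a, by simp [haC]⟩
    (by simp [h.left_notMem]; exact fun hx => (hC' x hx).2.1 rfl)
    (by simp [h.right_notMem, hyC]) x
  simp only [Finset.mem_union, not_or] at hv huX
  rcases hv with hv | hv
  · rcases h.closed v hv u hu huX.1 hvu with rfl | rfl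
    · exact absurd rfl huc
    · exact absurd haC huX.2
  · exact ⟨v, hv, u, by simp [hu, huc, huX.1], huX.2, hvu⟩

/-- A heavy path through the small side of a cut extends to the whole graph. -/
lemma heavyPath (hw : IsWeight G w) (hL : Linked G S x y) (h : IsCut G S x y a A)
    (hp : HeavyPath G w (insert x (insert a A)) x a d) : HeavyPath G w S x y d := by
  obtain ⟨l, hl, hla, hd⟩ := hp
  obtain ⟨m, hm, hmy⟩ := h.exists_path hL
  have hmS : ∀ v ∈ m, v ∈ S ∧ v ≠ x ∧ v ∉ A := fun v hv => by simpa using hm.subset v hv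
  obtain ⟨m, rfl⟩ : ∃ m', m = a :: m' := by
    cases m with
    | nil => simp at hmy
    | cons b m => have := hm.head; simp at this; subst this; exact ⟨m, rfl⟩
  cases m with
  | nil =>
    have hay : a = y := by simpa using hmy
    subst hay
    exact ⟨l, hl.mono fun v hv => h.side_subset hL (hl.subset v hv), hla, hd⟩
  | cons b m =>
    have hab : G.Adj a b := hm.chain.rel
    have hm' : IsPathFrom G (S \ insert x A) b (b :: m) :=
      ⟨hm.chain.of_cons, hm.nodup.of_cons, fun v hv => hm.subset v (List.mem_cons_of_mem _ hv), rfl⟩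
    refine ⟨l ++ b :: m, hl.append hm' hla hab ?_ (h.side_subset hL) (by simp; tauto), ?_, ?_⟩
    · intro v hv hvm
      have h1 := hl.subset v hv
      have h2 := hmS v (List.mem_cons_of_mem _ hvm)
      have h3 : a ∉ b :: m := (List.nodup_cons.1 hm.nodup).1
      simp only [Finset.mem_insert] at h1
      rcases h1 with rfl | rfl | h1
      · exact h2.2.1 rfl
      · exact h3 hvm
      · exact h2.2.2 h1
    · rw [List.getLast?_append]; simpa using hmy
    · rw [listWeight_append w hla (v := b) rfl]
      have := hw.nonneg a b
      have := listWeight_nonneg hw.nonneg (b :: m)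
      linarith

end IsCut

/-- Deleting a terminal either preserves linkedness or reveals a cut. -/
lemma Linked.erase_or_isCut (hL : Linked G S x y) {x' : V} (hx' : x' ∈ S) (hxx' : x' ≠ x)
    (hyx' : x' ≠ y) :
    Linked G (S.erase x) x' y ∨ ∃ a A, IsCut G S x y a A ∧ x' ∉ A := by
  by_contra! hcon
  obtain ⟨h1, h2⟩ := hcon
  refine h1 ⟨by simp [*], by simp [hL.right_mem, hL.ne.symm], hyx', fun X hX hne hx hy c => ?_⟩
  have hX' : ∀ v ∈ X, v ≠ x ∧ v ∈ S := fun v hv => by simpa using hX hv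
  by_contra! hc
  have hxX : x ∉ X := fun hh => (hX' x hh).1 rfl
  obtain ⟨v, hv, u, hu, huX, hux, hvu⟩ := hL.expand X (fun v hv => (hX' v hv).2) hne hxX hy x
  have huc : u = c := by
    by_contra huc
    exact hc v hv u (by simp [hux, hu]) huX huc hvu
  subst huc
  refine hx (h2 u X ⟨fun v hv => (hX' v hv).2, hne, hxX, hy, hu, hux, huX, fun v hv t ht htX hvt => ?_⟩)
  by_contra! hh
  exact hc v hv t (by simp [hh.1, ht]) htX hh.2 hvt

/-- The terminal `x` has a heaviest neighbour among the other non-terminals. -/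
lemma Linked.exists_max_adj (hw : IsWeight G w) (hL : Linked G S x y)
    (hne : ∃ v ∈ S, v ≠ x ∧ v ≠ y) :
    ∃ x' ∈ S, x' ≠ x ∧ x' ≠ y ∧ G.Adj x x' ∧ ∀ v ∈ S, v ≠ x → v ≠ y → w x v ≤ w x x' := by
  classical
  let X := (S.erase x).erase y
  have hX : ∀ v, v ∈ X ↔ v ≠ y ∧ v ≠ x ∧ v ∈ S := by simp [X]
  obtain ⟨v₀, hv₀, h1, h2⟩ := hne
  obtain ⟨v, hv, u, hu, huX, hux, hvu⟩ := hL.expand X (fun v hv => ((hX v).1 hv).2.2)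
    ⟨v₀, (hX _).2 ⟨h2, h1, hv₀⟩⟩ (by simp [X]) (by simp [X]) y
  have hux' : u = x := by
    by_contra hh; exact huX ((hX u).2 ⟨hux, hh, hu⟩)
  subst hux'
  obtain ⟨m, hm, hmax⟩ := (X.filter (G.Adj u)).exists_max_image (w u) ⟨v, by simp [hv, hvu.symm]⟩
  simp only [Finset.mem_filter, hX] at hm hmax
  refine ⟨m, hm.1.2.2, hm.1.2.1, hm.1.1, hm.2, fun t ht h1 h2 => ?_⟩
  by_cases hut : G.Adj u t
  · exact hmax t ⟨⟨h2, h1, ht⟩, hut⟩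
  · rw [hw.eq_zero _ _ hut]; exact hw.nonneg _ _

lemma degreeIn_erase (hx : x ∈ S) (v : V) :
    degreeIn w (S.erase x) v = degreeIn w S v - w v x := by
  rw [degreeIn, degreeIn, ← Finset.add_sum_erase S _ hx]; ring

lemma IsCut.card_lt (hL : Linked G S x y) (h : IsCut G S x y a A) {x' : V} (hx' : x' ∈ S)
    (hxx' : x' ≠ x) (hyx' : x' ≠ y) (hA : x' ∉ A) : (insert x (insert a A)).card < S.card := by
  refine Finset.card_lt_card ⟨h.side_subset hL, fun hh => ?_⟩
  have h1 := hh hx'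
  have h2 := hh hL.right_mem
  simp only [Finset.mem_insert, hxx', hA, hL.ne.symm, h.right_notMem, false_or, or_false] at h1 h2
  exact hyx' (h1.trans h2.symm)

/-- If all non-terminals have weighted degree at least `d`, there is a path of weight at least `d`
between the terminals. -/
theorem heavyPath_of_degree (hw : IsWeight G w) (hL : Linked G S x y)
    (hne : ∃ v ∈ S, v ≠ x ∧ v ≠ y) (hd : ∀ v ∈ S, v ≠ x → v ≠ y → d ≤ degreeIn w S v) :
    HeavyPath G w S x y d := by
  induction hn : S.card using Nat.strong_induction_on generalizing S x y d with
  | _ n ih =>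
  obtain ⟨x', hx', hxx', hyx', hadj, hmax⟩ := hL.exists_max_adj hw hne
  by_cases hone : ∀ v ∈ S, v = x ∨ v = y ∨ v = x'
  · have hS : S = {x, y, x'} := by
      ext v
      simp only [Finset.mem_insert, Finset.mem_singleton]
      refine ⟨hone v, ?_⟩
      rintro (rfl | rfl | rfl)
      exacts [hL.left_mem, hL.right_mem, hx']
    have h1 := hd x' hx' hxx' hyx'
    rw [degreeIn, hS, Finset.sum_insert (by simp [hL.ne, hxx'.symm]),
      Finset.sum_insert (by simp [hyx'.symm]), Finset.sum_singleton,
      hw.eq_zero x' x' (G.loopless.irrefl x'), hw.symm x' x] at h1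
    obtain ⟨v, hv, u, hu, huX, hux, hvu⟩ := hL.expand {x'} (by simpa) (by simp)
      (by simpa using hxx'.symm) (by simpa using hyx'.symm) x
    simp only [Finset.mem_singleton] at hv huX
    subst hv
    obtain rfl : u = y := by
      rcases hone u hu with h | h | h
      exacts [absurd h hux, h, absurd h huX]
    exact ⟨[x, v, u], ⟨by simp [hadj, hvu], by simp [hxx'.symm, hL.ne, hyx'],
      by simp [hL.left_mem, hx', hu], rfl⟩, rfl, by simpa using h1⟩
  push Not at hone
  obtain ⟨t, ht, htx, hty, htx'⟩ := hone
  rcases hL.erase_or_isCut hx' hxx' hyx' with hL' | ⟨a, A, hA, hx'A⟩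
  · refine HeavyPath.cons hadj hL.left_mem (ih _ ?_ hL' ⟨t, by simp [*], htx', hty⟩ ?_ rfl)
    · rw [← hn]; exact Finset.card_erase_lt_of_mem hL.left_mem
    · intro v hv hvx' hvy
      simp only [Finset.mem_erase] at hv
      rw [degreeIn_erase hL.left_mem, hw.symm v x]
      linarith [hd v hv.2 hv.1 hvy, hmax v hv.2 hv.1 hvy]
  · refine hA.heavyPath hw hL (ih _ ?_ (hA.linked hL) ?_ ?_ rfl)
    · rw [← hn]; exact hA.card_lt hL hx' hxx' hyx' hx'A
    · obtain ⟨v, hv⟩ := hA.nonempty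
      exact ⟨v, by simp [hv], fun h => hA.left_notMem (h ▸ hv), fun h => hA.notMem (h ▸ hv)⟩
    · intro v hv hvx hva
      have hvA : v ∈ A := by simpa [hvx, hva] using hv
      rw [hA.degreeIn_eq hw hL hvA]
      exact hd v (hA.subset hvA) hvx (fun h => hA.right_notMem (h ▸ hvA))

/-- In the absence of a heavy path, the small side of a cut contains a light vertex. -/
lemma IsCut.exists_light (hw : IsWeight G w) (hL : Linked G S x y) (h : IsCut G S x y a A)
    (hno : ¬ HeavyPath G w S x y d) : ∃ v ∈ A, degreeIn w S v < d := by
  by_contra! hcon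
  refine hno (h.heavyPath hw hL (heavyPath_of_degree hw (h.linked hL) ?_ ?_))
  · obtain ⟨v, hv⟩ := h.nonempty
    exact ⟨v, by simp [hv], fun hh => h.left_notMem (hh ▸ hv), fun hh => h.notMem (hh ▸ hv)⟩
  · intro v hv hvx hva
    have hvA : v ∈ A := by simpa [hvx, hva] using hv
    rw [h.degreeIn_eq hw hL hvA]
    exact hcon v hvA

end WGraph

namespace WGraph

variable {V : Type*} [DecidableEq V] {G : SimpleGraph V} {w : V → V → ℝ} {S : Finset V}
  {x y a b : V} {d : ℝ} {A D : Finset V}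

/-- If `{x, y}` separates `A` from something else, it also cuts off the rest of `S`. -/
lemma IsCut.compl (hL : Linked G S x y) (h : IsCut G S x y y A) {z : V} (hz : z ∈ S)
    (hzx : z ≠ x) (hzy : z ≠ y) (hzA : z ∉ A) :
    IsCut G S x y y (S \ insert x (insert y A)) where
  subset := Finset.sdiff_subset
  nonempty := ⟨z, by simp [*]⟩
  left_notMem := by simp
  right_notMem := by simp
  mem := hL.right_mem
  ne := hL.ne.symm
  notMem := by simp
  closed v hv u hu hun hvu := by
    simp only [Finset.mem_sdiff, Finset.mem_insert, not_or, hu, true_and] at hv hun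
    by_contra! hcon
    have huA : u ∈ A := by tauto
    rcases h.closed u huA v hv.1 hv.2.2.2 hvu.symm with rfl | rfl
    · exact hv.2.1 rfl
    · exact hv.2.2.1 rfl

lemma not_adj_compl (h : IsCut G S x y y A) {u v : V} (hu : u ∈ A)
    (hv : v ∈ S \ insert x (insert y A)) : u ≠ v ∧ ¬ G.Adj u v := by
  simp only [Finset.mem_sdiff, Finset.mem_insert, not_or] at hv
  refine ⟨fun h => hv.2.2.2 (h ▸ hu), fun huv => ?_⟩
  rcases h.closed u hu v hv.1 hv.2.2.2 huv with rfl | rfl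
  · exact hv.2.1 rfl
  · exact hv.2.2.1 rfl

/-- Two cuts, one at `x` and one at `y`, are either independent of each other, or the vertices
outside of both are separated by `{x, y}` from the other ones. -/
lemma IsCut.crossing (hL : Linked G S x y) (hA : IsCut G S x y a A) (hD : IsCut G S y x b D)
    (hay : a ≠ y) (hbx : b ≠ x) {x' : V} (hx' : x' ∈ S) (hxx' : x' ≠ x) (hyx' : x' ≠ y)
    (hadj : G.Adj x x') (hx'A : x' ∉ A) :
    (∃ R, IsCut G S x y y R ∧ a ∉ R) ∨ (Disjoint A D ∧ a ∉ D ∧ b ∉ A) := by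
  have hx'D : x' ∉ D := fun h => by
    rcases hD.closed x' h x hL.left_mem hD.right_notMem hadj.symm with h | h
    · exact hL.ne h
    · exact hbx h.symm
  have key : (a ∈ D ∧ b ∈ A) ∨ (Disjoint A D ∧ a ∉ D ∧ b ∉ A) := by
    by_cases hdis : Disjoint A D
    · by_cases ha : a ∈ D
      · refine Or.inl ⟨ha, ?_⟩
        obtain ⟨v, hv, hva⟩ := hA.exists_adj_right hL
        have hvD : v ∉ D := Finset.disjoint_left.1 hdis hv
        rcases hD.closed a ha v (hA.subset hv) hvD hva.symm with rfl | rfl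
        · exact absurd hv hA.right_notMem
        · exact hv
      · by_cases hb : b ∈ A
        · obtain ⟨v, hv, hvb⟩ := hD.exists_adj_right hL.symm
          have hvA : v ∉ A := Finset.disjoint_right.1 hdis hv
          rcases hA.closed b hb v (hD.subset hv) hvA hvb.symm with rfl | rfl
          · exact absurd hv hD.right_notMem
          · exact absurd hv ha
        · exact Or.inr ⟨hdis, ha, hb⟩
    · have hne : (A ∩ D).Nonempty := Finset.not_disjoint_iff_nonempty_inter.1 hdis
      have hsub : A ∩ D ⊆ S := Finset.inter_subset_left.trans hA.subset
      have hx : x ∉ A ∩ D := fun h => hA.left_notMem (Finset.mem_inter.1 h).1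
      have hy : y ∉ A ∩ D := fun h => hA.right_notMem (Finset.mem_inter.1 h).1
      refine Or.inl ⟨?_, ?_⟩
      · obtain ⟨v, hv, u, hu, huX, hub, hvu⟩ := hL.expand _ hsub hne hx hy b
        obtain ⟨hvA, hvD⟩ := Finset.mem_inter.1 hv
        by_cases huD : u ∈ D
        · have huA : u ∉ A := fun h => huX (Finset.mem_inter.2 ⟨h, huD⟩)
          rcases hA.closed v hvA u hu huA hvu with rfl | rfl
          · exact absurd huD hD.right_notMem
          · exact huD
        · rcases hD.closed v hvD u hu huD hvu with rfl | rfl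
          · rcases hA.closed v hvA u hu hA.right_notMem hvu with h | h
            · exact absurd h.symm hL.ne
            · exact absurd h.symm hay
          · exact absurd rfl hub
      · obtain ⟨v, hv, u, hu, huX, hua, hvu⟩ := hL.expand _ hsub hne hx hy a
        obtain ⟨hvA, hvD⟩ := Finset.mem_inter.1 hv
        by_cases huA : u ∈ A
        · have huD : u ∉ D := fun h => huX (Finset.mem_inter.2 ⟨huA, h⟩)
          rcases hD.closed v hvD u hu huD hvu with rfl | rfl
          · exact absurd huA hA.right_notMem
          · exact huA
        · rcases hA.closed v hvA u hu huA hvu with rfl | rfl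
          · rcases hD.closed v hvD u hu hD.right_notMem hvu with h | h
            · exact absurd h hL.ne
            · exact absurd h.symm hbx
          · exact absurd rfl hua
  refine key.imp_left fun ⟨haD, hbA⟩ => ⟨S \ (A ∪ D ∪ {x, y}), ⟨Finset.sdiff_subset,
    ⟨x', by simp [*]⟩, by simp, by simp, hL.right_mem, hL.ne.symm, by simp, ?_⟩, by simp [haD]⟩
  intro v hv u hu hun hvu
  simp only [Finset.mem_sdiff, Finset.mem_union, Finset.mem_insert, Finset.mem_singleton, not_or,
    hu, true_and] at hv hun
  by_contra! hcon
  have huAD : u ∈ A ∨ u ∈ D := by tauto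
  rcases huAD with huA | huD
  · rcases hA.closed u huA v hv.1 hv.2.1.1 hvu.symm with rfl | rfl
    · exact hv.2.2.1 rfl
    · exact hv.2.1.2 haD
  · rcases hD.closed u huD v hv.1 hv.2.1.2 hvu.symm with rfl | rfl
    · exact hv.2.2.2 rfl
    · exact hv.2.1.1 hbA

/-- If the light non-terminals form a clique, there is a heavy or a Hamiltonian path between the
terminals. -/
theorem heavyPath_or_hamPath (hw : IsWeight G w) (hL : Linked G S x y)
    (hne : ∃ v ∈ S, v ≠ x ∧ v ≠ y)
    (hd : ∀ u ∈ S, ∀ v ∈ S, u ≠ x → u ≠ y → v ≠ x → v ≠ y → u ≠ v → ¬ G.Adj u v →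
      d ≤ degreeIn w S u ∨ d ≤ degreeIn w S v) :
    HeavyPath G w S x y d ∨ HamPath G S x y := by
  by_contra! hcon
  obtain ⟨hno, hnoH⟩ := hcon
  have hno' : ¬ HeavyPath G w S y x d := fun h => hno (h.symm hw)
  induction hn : S.card using Nat.strong_induction_on generalizing S x y d with
  | _ n ih =>
  have step : ∀ x y, Linked G S x y → (∃ v ∈ S, v ≠ x ∧ v ≠ y) →
      (∀ u ∈ S, ∀ v ∈ S, u ≠ x → u ≠ y → v ≠ x → v ≠ y → u ≠ v → ¬ G.Adj u v →
        d ≤ degreeIn w S u ∨ d ≤ degreeIn w S v) →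
      ¬ HeavyPath G w S x y d → ¬ HamPath G S x y →
      ∃ x' ∈ S, x' ≠ x ∧ x' ≠ y ∧ G.Adj x x' ∧ ∃ a A, IsCut G S x y a A ∧ x' ∉ A := by
    clear! x y
    intro x y hL hne hd hno hnoH
    obtain ⟨x', hx', hxx', hyx', hadj, hmax⟩ := hL.exists_max_adj hw hne
    refine ⟨x', hx', hxx', hyx', hadj, ?_⟩
    by_cases hone : ∀ v ∈ S, v = x ∨ v = y ∨ v = x'
    · obtain ⟨v, hv, u, hu, huX, hux, hvu⟩ := hL.expand {x'} (by simpa) (by simp)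
        (by simpa using hxx'.symm) (by simpa using hyx'.symm) x
      simp only [Finset.mem_singleton] at hv huX
      subst hv
      obtain rfl : u = y := by
        rcases hone u hu with h | h | h
        exacts [absurd h hux, h, absurd h huX]
      refine absurd ⟨[x, v, u], ⟨by simp [hadj, hvu], by simp [hxx'.symm, hL.ne, hyx'],
        by simp [hL.left_mem, hx', hu], rfl⟩, rfl, fun t ht => ?_⟩ hnoH
      have := hone t ht
      simp only [List.mem_cons, List.not_mem_nil, or_false]; tauto
    push Not at hone
    obtain ⟨t, ht, htx, hty, htx'⟩ := hone
    refine (hL.erase_or_isCut hx' hxx' hyx').resolve_left fun hL' => ?_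
    have hno₂ : ¬ HeavyPath G w (S.erase x) x' y (d - w x x') :=
      fun h => hno (h.cons hadj hL.left_mem)
    refine ih (S.erase x).card ?_ hL' ⟨t, by simp [*], htx', hty⟩ ?_ hno₂
      (fun h => hnoH (h.cons hadj hL.left_mem)) (fun h => hno₂ (h.symm hw)) rfl
    · rw [← hn]; exact Finset.card_erase_lt_of_mem hL.left_mem
    · intro u hu v hv hux' huy hvx' hvy huv hadj'
      simp only [Finset.mem_erase] at hu hv
      rw [degreeIn_erase hL.left_mem, degreeIn_erase hL.left_mem, hw.symm v x, hw.symm u x]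
      have h1 := hmax u hu.2 hu.1 huy
      have h2 := hmax v hv.2 hv.1 hvy
      exact (hd u hu.2 v hv.2 hu.1 huy hv.1 hvy huv hadj').imp (fun _ => by linarith)
        (fun _ => by linarith)
  have light : ∀ u v, u ∈ S → v ∈ S → u ≠ x → u ≠ y → v ≠ x → v ≠ y → u ≠ v → ¬ G.Adj u v →
      degreeIn w S u < d → degreeIn w S v < d → False := by
    intro u v hu hv h1 h2 h3 h4 h5 h6 h7 h8
    rcases hd u hu v hv h1 h2 h3 h4 h5 h6 with h | h <;> linarith
  have nocut : ∀ R z, IsCut G S x y y R → z ∈ S → z ≠ x → z ≠ y → z ∉ R → False := by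
    intro R z hR hz hzx hzy hzR
    have hR' := hR.compl hL hz hzx hzy hzR
    obtain ⟨u, hu, hul⟩ := hR.exists_light hw hL hno
    obtain ⟨v, hv, hvl⟩ := hR'.exists_light hw hL hno
    obtain ⟨huv, hadj⟩ := not_adj_compl hR hu hv
    exact light u v (hR.subset hu) (hR'.subset hv) (fun h => hR.left_notMem (h ▸ hu))
      (fun h => hR.right_notMem (h ▸ hu)) (fun h => hR'.left_notMem (h ▸ hv))
      (fun h => hR'.right_notMem (h ▸ hv)) huv hadj hul hvl
  obtain ⟨x', hx', hxx', hyx', hadj, a, A, hA, hx'A⟩ := step x y hL hne hd hno hnoH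
  obtain ⟨y', hy', hyy', hxy', -, b, D, hD, hy'D⟩ := step y x hL.symm
    (by obtain ⟨v, h1, h2, h3⟩ := hne; exact ⟨v, h1, h3, h2⟩)
    (fun u hu v hv h1 h2 h3 h4 => hd u hu v hv h2 h1 h4 h3) hno' (fun h => hnoH h.symm)
  have hay : a ≠ y := by
    rintro rfl
    exact nocut A x' hA hx' hxx' hyx' hx'A
  have hbx : b ≠ x := by
    rintro rfl
    exact nocut D y' ⟨hD.subset, hD.nonempty, hD.right_notMem, hD.left_notMem, hL.right_mem,
      hL.ne.symm, hD.left_notMem, fun v hv u hu h1 h2 => (hD.closed v hv u hu h1 h2).symm⟩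
      hy' hxy' hyy' hy'D
  rcases hA.crossing hL hD hay hbx hx' hxx' hyx' hadj hx'A with ⟨R, hR, haR⟩ | ⟨hdis, haD, hbA⟩
  · exact nocut R a hR hA.mem hA.ne hay haR
  · obtain ⟨u, hu, hul⟩ := hA.exists_light hw hL hno
    obtain ⟨v, hv, hvl⟩ := hD.exists_light hw hL.symm hno'
    have hvA : v ∉ A := Finset.disjoint_right.1 hdis hv
    refine light u v (hA.subset hu) (hD.subset hv) (fun h => hA.left_notMem (h ▸ hu))
      (fun h => hA.right_notMem (h ▸ hu)) (fun h => hD.right_notMem (h ▸ hv))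
      (fun h => hD.left_notMem (h ▸ hv)) (fun h => hvA (h ▸ hu)) (fun huv => ?_) hul hvl
    rcases hA.closed u hu v (hD.subset hv) hvA huv with rfl | rfl
    · exact hD.right_notMem hv
    · exact haD hv

end WGraph

namespace WGraph

variable {V : Type*} {G : SimpleGraph V} {w : V → V → ℝ} {S T : Finset V}
  {x y z a b u v : V} {d : ℝ} {l s t P Q : List V}

lemma IsPathFrom.split (h : IsPathFrom G S x (s ++ b :: t)) (hs : s ≠ []) :
    IsPathFrom G S x s ∧ IsPathFrom G S b (b :: t) ∧ ∀ v ∈ s, v ∉ b :: t := by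
  have h1 := List.nodup_append.1 h.nodup
  refine ⟨⟨h.chain.left_of_append, h1.1, fun v hv => h.subset v (by simp [hv]), ?_⟩,
    ⟨h.chain.right_of_append, h1.2.1, fun v hv => h.subset v (List.mem_append_right _ hv), rfl⟩,
    fun v hv hv' => h1.2.2 v hv v hv' rfl⟩
  have := h.head
  rwa [List.head?_append_of_ne_nil _ hs] at this

lemma notMem_dropLast (hn : l.Nodup) (hu : l.getLast? = some u) : u ∉ l.dropLast := by
  rw [← List.dropLast_append_getLast? u hu] at hn
  have := (List.nodup_append.1 hn).2.2
  exact fun h => this u h u (by simp) rfl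

lemma IsPathFrom.dropLast (hl : IsPathFrom G T z l)
    (hu : l.getLast? = some u) (hzu : z ≠ u) : IsPathFrom G T z l.dropLast := by
  have h := List.dropLast_append_getLast? u hu
  refine ((h.symm ▸ hl : IsPathFrom G T z (l.dropLast ++ [u])).split fun h0 => hzu ?_).1
  have h1 := hl.head
  rw [← h, h0] at h1
  simpa using h1.symm

lemma sum_map_dropLast {f : V → ℝ} (hl : l.getLast? = some u) (hu : f u = 0) :
    (l.dropLast.map f).sum = (l.map f).sum := by
  conv_rhs => rw [← List.dropLast_append_getLast? u hl]
  simp [hu]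

lemma sum_map_tail {f : V → ℝ} (hl : l.head? = some x) :
    (l.tail.map f).sum = (l.map f).sum - f x := by
  cases l with
  | nil => simp at hl
  | cons a l => simp at hl; subst hl; simp

/-- Disjoint paths from `x` and from `b` that together cover `T`. -/
structure IsPathPair (G : SimpleGraph V) (T : Finset V) (x b : V) (P Q : List V) : Prop where
  left : IsPathFrom G T x P
  right : IsPathFrom G T b Q
  disjoint : ∀ v ∈ P, v ∉ Q
  cover : ∀ v ∈ T, v ∈ P ∨ v ∈ Q

lemma IsPathPair.symm (h : IsPathPair G T x b P Q) : IsPathPair G T b x Q P :=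
  ⟨h.right, h.left, fun v hv hv' => h.disjoint v hv' hv, fun v hv => (h.cover v hv).symm⟩

/-- The exchange inequality along an edge of a path pair of maximum weight. -/
lemma IsPathPair.edge_le (hw : IsWeight G w) (h : IsPathPair G T x b P Q)
    (hmax : ∀ P' Q', IsPathPair G T x b P' Q' →
      listWeight w P' + listWeight w Q' ≤ listWeight w P + listWeight w Q)
    (hno : ¬ HamPath G T x b) (hu : P.getLast? = some u) (hv : Q.getLast? = some v)
    {c e : V} (hP : P = s ++ c :: e :: t) : w u c + w v e ≤ w c e := by
  have hP' : P = (s ++ [c]) ++ e :: t := by simp [hP]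
  obtain ⟨h1, h2, h12⟩ := (hP' ▸ h.left).split (by simp)
  have hc : (s ++ [c]).getLast? = some c := by simp
  have hu' : (e :: t).getLast? = some u := by
    rw [hP', List.getLast?_append_of_ne_nil _ (by simp)] at hu; exact hu
  have hmem : ∀ v, v ∈ P ↔ v ∈ s ++ [c] ∨ v ∈ e :: t := fun v => by rw [hP', List.mem_append]
  have hwP : listWeight w P = listWeight w (s ++ [c]) + w c e + listWeight w (e :: t) := by
    rw [hP', listWeight_append w hc (v := e) rfl]
  have h2r := h2.reverse hu'
  by_cases huc : G.Adj u c
  · by_cases hve : G.Adj v e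
    · refine absurd ?_ hno
      have hQe := h.right.append h2 hv hve
        (fun z hz hz' => h.disjoint z ((hmem z).2 (Or.inr hz')) hz) (fun _ h => h) (fun _ h => h)
      have hQs := hQe.append (h1.reverse hc) (u := u)
        (by rw [List.getLast?_append_of_ne_nil _ (by simp)]; exact hu') huc (U := T) ?_
        (fun _ h => h) (fun _ h => h)
      · refine HamPath.symm ⟨_, hQs, ?_, ?_⟩
        · rw [List.getLast?_append_of_ne_nil _ (by simp)]; exact h1.getLast?_reverse
        · intro z hz
          have := h.cover z hz
          rw [hmem] at this
          simp only [List.mem_append, List.mem_reverse] at this ⊢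
          tauto
      · intro z hz hz'
        rw [List.mem_reverse] at hz'
        rcases List.mem_append.1 hz with hz | hz
        · exact h.disjoint z ((hmem z).2 (Or.inl hz')) hz
        · exact h12 z hz' hz
    · rw [hw.eq_zero v e hve]
      have := hmax _ _ ⟨h1.append h2r hc huc.symm (fun v hv hv' => h12 v hv (List.mem_reverse.1 hv')) (fun _ h => h)
        (fun _ h => h), h.right, ?_, ?_⟩
      · rw [listWeight_append w hc (v := u) h2r.head, listWeight_reverse w hw.symm, hwP,
          hw.symm c u] at this
        linarith
      · intro z hz
        refine h.disjoint z ((hmem z).2 ?_)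
        simpa only [List.mem_append, List.mem_reverse] using hz
      · intro z hz
        have := h.cover z hz
        rwa [hmem, ← List.mem_reverse (as := e :: t), ← List.mem_append] at this
  · rw [hw.eq_zero u c huc]
    by_cases hve : G.Adj v e
    · have := hmax _ _ ⟨h1, h.right.append h2 hv hve
        (fun z hz hz' => h.disjoint z ((hmem z).2 (Or.inr hz')) hz) (fun _ h => h) (fun _ h => h),
        ?_, ?_⟩
      · rw [listWeight_append w hv (v := e) rfl, hwP] at this
        linarith
      · intro z hz hz'
        rcases List.mem_append.1 hz' with hz' | hz'
        · exact h.disjoint z ((hmem z).2 (Or.inl hz)) hz'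
        · exact h12 z hz hz'
      · intro z hz
        have := h.cover z hz
        rw [hmem] at this
        simp only [List.mem_append] at this ⊢
        tauto
    · rw [hw.eq_zero v e hve]
      simpa using hw.nonneg c e

lemma sum_map_add_sum_map {f : V → ℝ} (hP : P.Nodup) (hQ : Q.Nodup) (hd : ∀ v ∈ P, v ∉ Q)
    (hT : ∀ v, v ∈ T ↔ v ∈ P ∨ v ∈ Q) : (P.map f).sum + (Q.map f).sum = ∑ v ∈ T, f v := by
  classical
  have hPQ : (P ++ Q).Nodup := List.nodup_append.2 ⟨hP, hQ, fun a ha b hb hab => hd a ha (hab ▸ hb)⟩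
  have : T = (P ++ Q).toFinset := by ext v; simp [hT]
  rw [this, List.sum_toFinset _ hPQ]; simp

lemma IsPathPair.exists_max [Finite V] (h : IsPathPair G T x b P Q) :
    ∃ P' Q', IsPathPair G T x b P' Q' ∧ ∀ P'' Q'', IsPathPair G T x b P'' Q'' →
      listWeight w P'' + listWeight w Q'' ≤ listWeight w P' + listWeight w Q' := by
  classical
  have := Fintype.ofFinite V
  have hlen : ∀ l : List V, l.Nodup → l.length ≤ Fintype.card V := fun l hl => hl.length_le_card
  let I := {p : List V × List V | IsPathPair G T x b p.1 p.2}
  have hfin : I.Finite :=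
    ((List.finite_length_le V (Fintype.card V)).prod
      (List.finite_length_le V (Fintype.card V))).subset
      fun p hp => ⟨hlen _ hp.left.nodup, hlen _ hp.right.nodup⟩
  obtain ⟨p, hp, hmax⟩ := hfin.exists_maximalFor (fun p => listWeight w p.1 + listWeight w p.2) I
    ⟨(P, Q), h⟩
  exact ⟨p.1, p.2, hp, fun P'' Q'' h'' => not_lt.1 fun hlt =>
    absurd (hmax (j := (P'', Q'')) h'' hlt.le) (not_le.2 hlt)⟩

/-- Without a Hamiltonian path joining the two start vertices, a covering path pair of maximum
weight is at least as heavy as the two end vertices together. -/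
lemma IsPathPair.exists_heavy [Finite V] (hw : IsWeight G w) (h : IsPathPair G T x b P Q)
    (hno : ¬ HamPath G T x b) :
    ∃ P Q u v, IsPathPair G T x b P Q ∧ P.getLast? = some u ∧ Q.getLast? = some v ∧
      (degreeIn w T u - w u b) + (degreeIn w T v - w v x) ≤ listWeight w P + listWeight w Q := by
  obtain ⟨P, Q, h, hmax⟩ := h.exists_max (w := w)
  obtain ⟨u, hu⟩ := h.left.exists_getLast?
  obtain ⟨v, hv⟩ := h.right.exists_getLast?
  refine ⟨P, Q, u, v, h, hu, hv, ?_⟩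
  have hP := sum_dropLast_add_sum_tail_le (w := w) (w u) (w v) P
    (fun s t c e hs => h.edge_le hw hmax hno hu hv hs)
  have hQ := sum_dropLast_add_sum_tail_le (w := w) (w v) (w u) Q
    (fun s t c e hs => h.symm.edge_le hw
      (fun P' Q' h' => by linarith [hmax _ _ h'.symm]) (fun h => hno h.symm) hv hu hs)
  rw [sum_map_dropLast hu (hw.eq_zero u u (G.loopless.irrefl u)), sum_map_tail h.left.head] at hP
  rw [sum_map_dropLast hv (hw.eq_zero v v (G.loopless.irrefl v)), sum_map_tail h.right.head] at hQ
  have hT : ∀ v, v ∈ T ↔ v ∈ P ∨ v ∈ Q := fun v =>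
    ⟨h.cover v, fun hv => hv.elim (h.left.subset v) (h.right.subset v)⟩
  have h1 := sum_map_add_sum_map (f := w u) h.left.nodup h.right.nodup h.disjoint hT
  have h2 := sum_map_add_sum_map (f := w v) h.left.nodup h.right.nodup h.disjoint hT
  rw [degreeIn, degreeIn, ← h1, ← h2]
  linarith

/-- Among the covering paths of `T` starting at `x` there is one at least as heavy as the weighted
degree of its end vertex. -/
lemma IsPathFrom.exists_heavy [Finite V] (hw : IsWeight G w) (h : IsPathFrom G T x P)
    (hc : ∀ v ∈ T, v ∈ P) :
    ∃ P u, IsPathFrom G T x P ∧ (∀ v ∈ T, v ∈ P) ∧ P.getLast? = some u ∧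
      degreeIn w T u ≤ listWeight w P := by
  classical
  have := Fintype.ofFinite V
  let I := {p : List V | IsPathFrom G T x p ∧ ∀ v ∈ T, v ∈ p}
  have hfin : I.Finite :=
    (List.finite_length_le V (Fintype.card V)).subset fun p hp => hp.1.nodup.length_le_card
  obtain ⟨P, ⟨h, hc⟩, hmax⟩ := hfin.exists_maximalFor (listWeight w) I ⟨P, h, hc⟩
  have hmax : ∀ P', IsPathFrom G T x P' → (∀ v ∈ T, v ∈ P') → listWeight w P' ≤ listWeight w P :=
    fun P' h' hc' => not_lt.1 fun hlt => absurd (hmax (j := P') ⟨h', hc'⟩ hlt.le) (not_le.2 hlt)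
  obtain ⟨u, hu⟩ := h.exists_getLast?
  refine ⟨P, u, h, hc, hu, ?_⟩
  have hP := sum_dropLast_add_sum_tail_le (w := w) (w u) (fun _ => 0) P ?_
  · rw [sum_map_dropLast hu (hw.eq_zero u u (G.loopless.irrefl u))] at hP
    have h1 := sum_map_add_sum_map (f := w u) (Q := []) (T := T) h.nodup (by simp) (by simp)
      (fun v => ⟨fun hv => Or.inl (hc v hv), fun hv => by simpa using hv.imp_left (h.subset v)⟩)
    rw [degreeIn, ← h1]
    simpa using hP
  · intro s t c e hs
    rw [add_zero]
    by_cases huc : G.Adj u c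
    · have hs' : P = (s ++ [c]) ++ e :: t := by simp [hs]
      obtain ⟨h1, h2, h12⟩ := (hs' ▸ h).split (by simp)
      have hc' : (s ++ [c]).getLast? = some c := by simp
      have hu' : (e :: t).getLast? = some u := by
        rw [hs', List.getLast?_append_of_ne_nil _ (by simp)] at hu; exact hu
      have := hmax _ (h1.append (h2.reverse hu') hc' huc.symm (fun v hv hv' => h12 v hv (List.mem_reverse.1 hv')) (fun _ h => h)
        (fun _ h => h)) (fun z hz => by
          have := hc z hz
          rwa [hs', List.mem_append, ← List.mem_reverse (as := e :: t), ← List.mem_append] at this)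
      rw [listWeight_append w hc' (v := u) (h2.reverse hu').head, listWeight_reverse w hw.symm, hs',
        listWeight_append w hc' (v := e) rfl, hw.symm c u] at this
      linarith
    · rw [hw.eq_zero u c huc]; exact hw.nonneg c e

end WGraph

namespace WGraph

variable {V : Type*} {G : SimpleGraph V} {w : V → V → ℝ} {S T : Finset V}
  {x y z a b u v : V} {d : ℝ} {l m P Q LA LD : List V}

/-- There are disjoint paths from `x` and from `y` of total weight at least `d`. -/
def HeavyPair (G : SimpleGraph V) (w : V → V → ℝ) (S : Finset V) (x y : V) (d : ℝ) : Prop :=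
  ∃ l m, IsPathFrom G S x l ∧ IsPathFrom G S y m ∧ (∀ v ∈ l, v ∉ m) ∧
    d ≤ listWeight w l + listWeight w m

/-- There are disjoint paths from `x` and from `y` that cover `S`. -/
def SpanPair (G : SimpleGraph V) (S : Finset V) (x y : V) : Prop :=
  ∃ l m, IsPathPair G S x y l m

/-- A heavy path or a heavy pair of paths. -/
def Heavy (G : SimpleGraph V) (w : V → V → ℝ) (S : Finset V) (x y : V) (d : ℝ) : Prop :=
  HeavyPath G w S x y d ∨ HeavyPair G w S x y d

lemma HeavyPair.symm (h : HeavyPair G w S x y d) : HeavyPair G w S y x d := by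
  obtain ⟨l, m, hl, hm, hd, h⟩ := h
  exact ⟨m, l, hm, hl, fun v hv hv' => hd v hv' hv, by linarith⟩

lemma SpanPair.symm (h : SpanPair G S x y) : SpanPair G S y x := by
  obtain ⟨l, m, h⟩ := h
  exact ⟨m, l, h.symm⟩

lemma Heavy.symm (hw : IsWeight G w) (h : Heavy G w S x y d) : Heavy G w S y x d :=
  h.imp (fun h => h.symm hw) HeavyPair.symm

lemma HeavyPath.heavy (hl : IsPathFrom G S x l) (hy : l.getLast? = some y)
    (h : d ≤ listWeight w l) : Heavy G w S x y d := Or.inl ⟨l, hl, hy, h⟩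

lemma Heavy.of_pair (hl : IsPathFrom G S x l) (hm : IsPathFrom G S y m) (hd : ∀ v ∈ l, v ∉ m)
    (h : d ≤ listWeight w l + listWeight w m) : Heavy G w S x y d :=
  Or.inr ⟨l, m, hl, hm, hd, h⟩

variable [DecidableEq V] {A D : Finset V}

lemma Heavy.cons (hxz : G.Adj x z) (hx : x ∈ S) (hxy : x ≠ y)
    (h : Heavy G w (S.erase x) z y (d - w x z)) : Heavy G w S x y d := by
  refine h.imp (fun h => h.cons hxz hx) ?_
  rintro ⟨l, m, hl, hm, hd, h⟩
  have hxl : ∀ l' z', IsPathFrom G (S.erase x) z' l' → x ∉ l' := fun l' z' hl' hh => by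
    simpa using hl'.subset x hh
  refine ⟨x :: l, m, hl.cons hxz (hxl _ _ hl) hx
    (fun v hv => Finset.mem_of_mem_erase (hl.subset v hv)),
    hm.mono fun v hv => Finset.mem_of_mem_erase (hm.subset v hv), ?_, ?_⟩
  · intro v hv
    rcases List.mem_cons.1 hv with rfl | hv
    exacts [hxl _ _ hm, hd v hv]
  · rw [listWeight_cons w hl.head]; linarith

lemma SpanPair.cons (hxz : G.Adj x z) (hx : x ∈ S)
    (h : SpanPair G (S.erase x) z y) : SpanPair G S x y := by
  obtain ⟨l, m, hl, hm, hd, h⟩ := h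
  have hxl : ∀ l' z', IsPathFrom G (S.erase x) z' l' → x ∉ l' := fun l' z' hl' hh => by
    simpa using hl'.subset x hh
  refine ⟨x :: l, m, hl.cons hxz (hxl _ _ hl) hx
    (fun v hv => Finset.mem_of_mem_erase (hl.subset v hv)),
    hm.mono fun v hv => Finset.mem_of_mem_erase (hm.subset v hv), ?_, ?_⟩
  · intro v hv
    rcases List.mem_cons.1 hv with rfl | hv
    exacts [hxl _ _ hm, hd v hv]
  · intro v hv
    by_cases hvx : v = x
    · simp [hvx]
    · exact (h v (Finset.mem_erase.2 ⟨hvx, hv⟩)).imp_left (List.mem_cons_of_mem _)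

/-- Independent cuts `{x, a}` and `{y, b}` whose small sides `A` and `D` are traversed by the
paths `LA` and `LD`. -/
structure CutPair (G : SimpleGraph V) (S : Finset V) (x y a b : V) (A D : Finset V)
    (LA LD : List V) : Prop where
  linked : Linked G S x y
  cutA : IsCut G S x y a A
  cutD : IsCut G S y x b D
  disj : Disjoint A D
  haD : a ∉ D
  hbA : b ∉ A
  hay : a ≠ y
  hbx : b ≠ x
  pathA : IsPathFrom G (insert x A) x LA
  lastA : ∃ u, LA.getLast? = some u ∧ G.Adj u a
  coverA : ∀ v ∈ A, v ∈ LA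
  pathD : IsPathFrom G (insert y D) y LD
  lastD : ∃ u, LD.getLast? = some u ∧ G.Adj u b
  coverD : ∀ v ∈ D, v ∈ LD

/-- The vertices outside of both cuts. -/
def rest (S : Finset V) (x y a b : V) (A D : Finset V) : Finset V :=
  S \ (A ∪ D ∪ {x, y, a, b})

lemma mem_rest : v ∈ rest S x y a b A D ↔
    v ∈ S ∧ v ∉ A ∧ v ∉ D ∧ v ≠ x ∧ v ≠ y ∧ v ≠ a ∧ v ≠ b := by
  simp only [rest, Finset.mem_sdiff, Finset.mem_union, Finset.mem_insert, Finset.mem_singleton]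
  tauto

namespace CutPair

lemma symm (C : CutPair G S x y a b A D LA LD) : CutPair G S y x b a D A LD LA :=
  ⟨C.linked.symm, C.cutD, C.cutA, C.disj.symm, C.hbA, C.haD, C.hbx, C.hay, C.pathD, C.lastD,
    C.coverD, C.pathA, C.lastA, C.coverA⟩

/-- A path from `a` is extended backwards through `A` to `x`. -/
lemma viaA (hw : IsWeight G w) (C : CutPair G S x y a b A D LA LD) (hm : IsPathFrom G T a m)
    (hT : ∀ v ∈ m, v ∈ S ∧ v ≠ x ∧ v ∉ A) :
    IsPathFrom G S x (LA ++ m) ∧ (∀ v ∈ LA ++ m, v = x ∨ v ∈ A ∨ v ∈ m) ∧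
      (LA ++ m).getLast? = m.getLast? ∧ listWeight w m ≤ listWeight w (LA ++ m) := by
  obtain ⟨u, hu, hua⟩ := C.lastA
  have hsub : ∀ v ∈ LA, v = x ∨ v ∈ A := fun v hv => by simpa using C.pathA.subset v hv
  refine ⟨?_, ?_, ?_, ?_⟩
  · refine C.pathA.append (hm.mono (T := S) fun v hv => (hT v hv).1) hu hua ?_ ?_ (fun _ h => h)
    · intro v hv hv'
      rcases hsub v hv with h | h
      exacts [(hT v hv').2.1 h, (hT v hv').2.2 h]
    · exact Finset.insert_subset C.linked.left_mem C.cutA.subset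
  · intro v hv
    rcases List.mem_append.1 hv with hv | hv
    · exact (hsub v hv).imp_right Or.inl
    · exact Or.inr (Or.inr hv)
  · exact List.getLast?_append_of_ne_nil _ hm.ne_nil
  · rw [listWeight_append w hu hm.head]
    have := hw.nonneg u a
    have := listWeight_nonneg hw.nonneg LA
    linarith

lemma viaD (hw : IsWeight G w) (C : CutPair G S x y a b A D LA LD) (hm : IsPathFrom G T b m)
    (hT : ∀ v ∈ m, v ∈ S ∧ v ≠ y ∧ v ∉ D) :
    IsPathFrom G S y (LD ++ m) ∧ (∀ v ∈ LD ++ m, v = y ∨ v ∈ D ∨ v ∈ m) ∧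
      (LD ++ m).getLast? = m.getLast? ∧ listWeight w m ≤ listWeight w (LD ++ m) :=
  C.symm.viaA hw hm hT

/-- The distinctness facts of a pair of independent cuts. -/
lemma facts (C : CutPair G S x y a b A D LA LD) :
    (x ∈ S ∧ y ∈ S ∧ a ∈ S ∧ b ∈ S) ∧ (x ≠ y ∧ a ≠ x ∧ a ≠ y ∧ b ≠ x ∧ b ≠ y) ∧
      (x ∉ A ∧ y ∉ A ∧ a ∉ A ∧ b ∉ A) ∧ (x ∉ D ∧ y ∉ D ∧ a ∉ D ∧ b ∉ D) ∧
      (∀ v ∈ A, v ∈ S) ∧ (∀ v ∈ D, v ∈ S) ∧ (∀ v ∈ A, v ∉ D) :=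
  ⟨⟨C.linked.left_mem, C.linked.right_mem, C.cutA.mem, C.cutD.mem⟩,
    ⟨C.linked.ne, C.cutA.ne, C.hay, C.hbx, C.cutD.ne⟩,
    ⟨C.cutA.left_notMem, C.cutA.right_notMem, C.cutA.notMem, C.hbA⟩,
    ⟨C.cutD.right_notMem, C.cutD.left_notMem, C.haD, C.cutD.notMem⟩,
    fun _ h => C.cutA.subset h, fun _ h => C.cutD.subset h,
    fun _ h => Finset.disjoint_left.1 C.disj h⟩

lemma spanPair_of_ne (hw : IsWeight G w) (C : CutPair G S x y a b A D LA LD) (hab : a ≠ b)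
    (hP : IsPathFrom G (insert a (rest S x y a b A D)) a P)
    (hQ : IsPathFrom G (insert b (rest S x y a b A D)) b Q)
    (hd : ∀ v ∈ P, v ∉ Q) (hc : ∀ v ∈ rest S x y a b A D, v ∈ P ∨ v ∈ Q) :
    SpanPair G S x y := by
  obtain ⟨f1, f2, f3, f4, f5, f6, f7⟩ := C.facts
  have hP' : ∀ v ∈ P, v = a ∨ v ∈ rest S x y a b A D := fun v hv => by simpa using hP.subset v hv
  have hQ' : ∀ v ∈ Q, v = b ∨ v ∈ rest S x y a b A D := fun v hv => by simpa using hQ.subset v hv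
  simp only [mem_rest] at hP' hQ' hc
  obtain ⟨h1, h2, -⟩ := C.viaA hw hP (by grind)
  obtain ⟨h3, h4, -⟩ := C.viaD hw hQ (by grind)
  refine ⟨_, _, h1, h3, by grind, ?_⟩
  have hx := C.pathA.head_mem
  have hy := C.pathD.head_mem
  have ha := hP.head_mem
  have hb := hQ.head_mem
  have hA := C.coverA
  have hD := C.coverD
  simp only [List.mem_append]
  grind

lemma spanPair_of_right (hw : IsWeight G w) (C : CutPair G S x y a b A D LA LD)
    (hQ : IsPathFrom G (insert b (rest S x y a b A D)) b Q)
    (hc : ∀ v ∈ rest S x y a b A D, v ∈ Q) : SpanPair G S x y := by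
  have hQ' : ∀ v ∈ Q, v = b ∨ v ∈ rest S x y a b A D := fun v hv => by simpa using hQ.subset v hv
  by_cases hab : a = b
  · obtain ⟨f1, f2, f3, f4, f5, f6, f7⟩ := C.facts
    subst hab
    simp only [mem_rest] at hQ' hc
    obtain ⟨h3, h4, -⟩ := C.viaD hw hQ (by grind)
    have hsub : ∀ v ∈ LA, v = x ∨ v ∈ A := fun v hv => by simpa using C.pathA.subset v hv
    refine ⟨LA, _, C.pathA.mono (by grind), h3, by grind, ?_⟩
    have hx := C.pathA.head_mem
    have hy := C.pathD.head_mem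
    have hb := hQ.head_mem
    have hA := C.coverA
    have hD := C.coverD
    simp only [List.mem_append]
    grind
  · refine C.spanPair_of_ne hw hab (P := [a]) (IsPathFrom.singleton (by simp)) hQ ?_ ?_
    · intro v hv hv'
      obtain rfl := List.mem_singleton.1 hv
      rcases hQ' v hv' with h | h
      · exact hab h
      · simp [mem_rest] at h
    · intro v hv; exact Or.inr (hc v hv)

lemma degreeIn_eq (hw : IsWeight G w) (C : CutPair G S x y a b A D LA LD)
    (hu : u ∈ rest S x y a b A D) :
    degreeIn w S u = degreeIn w (rest S x y a b A D) u + w u x + w u y + w u b +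
      if a = b then 0 else w u a := by
  have h1 : degreeIn w S u = degreeIn w (insert x (insert y (insert b (insert a
      (rest S x y a b A D))))) u := by
    refine (Finset.sum_subset ?_ fun v hv hvn => hw.eq_zero _ _ fun huv => ?_).symm
    · intro v hv
      simp only [Finset.mem_insert, mem_rest] at hv
      rcases hv with rfl | rfl | rfl | rfl | hv
      exacts [C.linked.left_mem, C.linked.right_mem, C.cutD.mem, C.cutA.mem, hv.1]
    · rw [mem_rest] at hu
      simp only [Finset.mem_insert, mem_rest, not_or] at hvn
      have hvAD : v ∈ A ∨ v ∈ D := by tauto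
      rcases hvAD with h | h
      · have := C.cutA.closed v h u hu.1 hu.2.1 huv.symm
        tauto
      · have := C.cutD.closed v h u hu.1 hu.2.2.1 huv.symm
        tauto
  have h2 := C.cutA.ne
  have h3 := C.cutD.ne
  have h4 := C.linked.ne
  have h5 := C.hay
  have h6 := C.hbx
  rw [h1, degreeIn, degreeIn]
  split_ifs with hab
  · subst hab
    rw [Finset.insert_idem, Finset.sum_insert (by simp [mem_rest, h4, h2.symm]),
      Finset.sum_insert (by simp [mem_rest, h5.symm]), Finset.sum_insert (by simp [mem_rest])]
    ring
  · rw [Finset.sum_insert (by simp [mem_rest, h4, h2.symm, h6.symm]),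
      Finset.sum_insert (by simp [mem_rest, h5.symm, h3.symm]),
      Finset.sum_insert (by simp [mem_rest, Ne.symm hab]), Finset.sum_insert (by simp [mem_rest])]
    ring

end CutPair

end WGraph

namespace WGraph

variable {V : Type*} [DecidableEq V] {G : SimpleGraph V} {w : V → V → ℝ} {S T : Finset V}
  {x y z a b u v : V} {d : ℝ} {l m P Q LA LD : List V} {A D : Finset V}

namespace CutPair

/-- Joining the two paths of a path pair at `b` and closing up at `y`. -/
lemma heavy_join (hw : IsWeight G w) (C : CutPair G S x y a b A D LA LD)
    (hP : IsPathFrom G S x P) (hQ : IsPathFrom G S b Q) (hd : ∀ v ∈ P, v ∉ Q)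
    (hPD : ∀ v ∈ P, v ≠ y ∧ v ∉ D) (hQD : ∀ v ∈ Q, v ≠ y ∧ v ∉ D)
    (hu : P.getLast? = some u) (hv : Q.getLast? = some v)
    (h : d ≤ listWeight w P + listWeight w Q + w u b + w v y) : Heavy G w S x y d := by
  obtain ⟨f1, f2, f3, f4, f5, f6, f7⟩ := C.facts
  have hyS : IsPathFrom G S y [y] := IsPathFrom.singleton C.linked.right_mem
  by_cases hub : G.Adj u b
  · have hPQ := hP.append hQ hu hub hd (fun _ h => h) (fun _ h => h)
    have hPQv : (P ++ Q).getLast? = some v := by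
      rw [List.getLast?_append_of_ne_nil _ hQ.ne_nil, hv]
    have hwt := listWeight_append w hu hQ.head
    by_cases hvy : G.Adj v y
    · refine HeavyPath.heavy (hPQ.append hyS hPQv hvy (by grind) (fun _ h => h) (fun _ h => h))
        (by simp) ?_
      rw [listWeight_append w hPQv (v := y) rfl, hwt]
      simpa using by linarith
    · refine Heavy.of_pair hPQ hyS (by grind) ?_
      rw [hw.eq_zero v y hvy] at h
      rw [hwt]; simpa using by linarith
  · rw [hw.eq_zero u b hub] at h
    by_cases hvy : G.Adj v y
    · refine Heavy.of_pair hP ((hQ.reverse hv).cons hvy.symm (by grind) C.linked.right_mem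
        (hQ.reverse hv).subset) (by grind) ?_
      rw [listWeight_cons w (hQ.reverse hv).head, listWeight_reverse w hw.symm, hw.symm y v]
      linarith
    · rw [hw.eq_zero v y hvy] at h
      obtain ⟨h1, h2, -, h3⟩ := C.viaD hw hQ (by grind [hQ.subset])
      exact Heavy.of_pair hP h1 (by grind) (by linarith)

/-- Extending one path of a path pair to `a`, and closing up the other one at `y`. -/
lemma heavy_extend (hw : IsWeight G w) (C : CutPair G S x y a b A D LA LD)
    (hP : IsPathFrom G S x P) (hQ : IsPathFrom G S b Q) (hd : ∀ v ∈ P, v ∉ Q)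
    (hPD : ∀ v ∈ P, v ≠ y ∧ v ∉ D ∧ v ≠ a) (hQD : ∀ v ∈ Q, v ≠ y ∧ v ∉ D ∧ v ≠ a)
    (hu : P.getLast? = some u) (hv : Q.getLast? = some v)
    (h : d ≤ listWeight w P + listWeight w Q + w u a + w v y) : Heavy G w S x y d := by
  obtain ⟨f1, f2, f3, f4, f5, f6, f7⟩ := C.facts
  obtain ⟨P', hP', hPP', hwt⟩ := hP.exists_extend hw hu (z := a) (by grind) C.cutA.mem
  by_cases hvy : G.Adj v y
  · refine Heavy.of_pair hP' ((hQ.reverse hv).cons hvy.symm (by grind) C.linked.right_mem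
      (hQ.reverse hv).subset) (by grind) ?_
    rw [listWeight_cons w (hQ.reverse hv).head, listWeight_reverse w hw.symm, hw.symm y v]
    linarith
  · rw [hw.eq_zero v y hvy] at h
    obtain ⟨h1, h2, -, h3⟩ := C.viaD hw hQ (by grind [hQ.subset])
    exact Heavy.of_pair hP' h1 (by grind) (by linarith)

/-- A path from `x` inside `A ∪ {x, a, v}` that collects the weights of both `vx` and `va`. -/
lemma exists_fork (hw : IsWeight G w) (C : CutPair G S x y a b A D LA LD) (hvS : v ∈ S)
    (hva : v ≠ a) (hvx : v ≠ x) (hvA : v ∉ A) :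
    ∃ l, IsPathFrom G S x l ∧ (∀ t ∈ l, t = x ∨ t ∈ A ∨ t = a ∨ t = v) ∧
      w v x + w v a ≤ listWeight w l := by
  obtain ⟨f1, f2, f3, f4, f5, f6, f7⟩ := C.facts
  by_cases hadj : G.Adj v x
  · have h0 : IsPathFrom G S x [x, v] :=
      (IsPathFrom.singleton hvS).cons hadj.symm (by simpa using hvx.symm) f1.1 (by simpa)
    obtain ⟨l, hl, hlm, hwt⟩ := h0.exists_extend hw (u := v) rfl (z := a) (by grind) f1.2.2.1
    refine ⟨l, hl, by grind, ?_⟩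
    simp only [listWeight_cons_cons, listWeight_singleton, add_zero] at hwt
    rw [hwt, hw.symm v x]
  · obtain ⟨h1, h2, h3, h4⟩ := C.viaA hw (IsPathFrom.singleton f1.2.2.1) (m := [a]) (by grind)
    obtain ⟨l, hl, hlm, hwt⟩ := h1.exists_extend hw (u := a) (by rw [h3]; rfl) (z := v)
      (by grind) hvS
    refine ⟨l, hl, by grind, ?_⟩
    simp only [listWeight_singleton] at h4
    rw [hwt, hw.eq_zero v x hadj, hw.symm v a]
    linarith

/-- The four edges `uy`, `ua`, `va`, `vx`, the first of which is present. -/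
lemma heavy_four_of_adj (hw : IsWeight G w) (C : CutPair G S x y a b A D LA LD)
    (hu : u ∈ rest S x y a b A D) (hv : v ∈ rest S x y a b A D) (huv : u ≠ v)
    (huy : G.Adj u y) (h : d ≤ w u y + w u a + w v a + w v x) : Heavy G w S x y d := by
  obtain ⟨f1, f2, f3, f4, f5, f6, f7⟩ := C.facts
  rw [mem_rest] at hu hv
  have hyu : IsPathFrom G S y [y, u] :=
    (IsPathFrom.singleton hu.1).cons huy.symm (by grind) f1.2.1 (by grind)
  by_cases hua : G.Adj u a
  · have hyua : IsPathFrom G S y ([y, u] ++ [a]) := hyu.append (IsPathFrom.singleton f1.2.2.1)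
      (u := u) rfl hua (by grind) (fun _ h => h) (fun _ h => h)
    by_cases hva : G.Adj v a
    · have hyuav : IsPathFrom G S y ([y, u, a] ++ [v]) := hyua.append (IsPathFrom.singleton hv.1)
        (u := a) rfl hva.symm (by grind) (fun _ h => h) (fun _ h => h)
      by_cases hvx : G.Adj v x
      · refine Heavy.symm hw (HeavyPath.heavy (l := [y, u, a, v] ++ [x]) (hyuav.append
          (IsPathFrom.singleton f1.1) (u := v) rfl hvx (by grind) (fun _ h => h) (fun _ h => h))
          (by simp) ?_)
        simp [hw.symm y u, hw.symm a v]; linarith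
      · refine Heavy.of_pair (IsPathFrom.singleton f1.1) hyuav (by grind) ?_
        rw [hw.eq_zero v x hvx] at h
        simp [hw.symm y u, hw.symm a v]; linarith
    · obtain ⟨l, hl, hlm, hwt⟩ := (IsPathFrom.singleton f1.1).exists_extend hw (u := x) (z := v)
        rfl (by grind) hv.1
      refine Heavy.of_pair hl hyua (by grind) ?_
      rw [hw.eq_zero v a hva, hw.symm v x] at h
      rw [hwt]
      simp [hw.symm y u]; linarith
  · obtain ⟨l, hl, hlm, hwt⟩ := C.exists_fork hw hv.1 hv.2.2.2.2.2.1 hv.2.2.2.1 hv.2.1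
    refine Heavy.of_pair hl hyu (by grind) ?_
    rw [hw.eq_zero u a hua] at h
    simp [hw.symm y u]; linarith

/-- The three edges `ub`, `va`, `vx`. -/
lemma heavy_three (hw : IsWeight G w) (C : CutPair G S x y a b A D LA LD) (hab : a ≠ b)
    (hu : u ∈ rest S x y a b A D) (hv : v ∈ rest S x y a b A D) (huv : u ≠ v)
    (h : d ≤ w u b + w v a + w v x) : Heavy G w S x y d := by
  obtain ⟨f1, f2, f3, f4, f5, f6, f7⟩ := C.facts
  rw [mem_rest] at hu hv
  obtain ⟨l, hl, hlm, hwt⟩ := C.exists_fork hw hv.1 hv.2.2.2.2.2.1 hv.2.2.2.1 hv.2.1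
  obtain ⟨h1, h2, h3, h4⟩ := C.viaD hw (IsPathFrom.singleton f1.2.2.2) (m := [b]) (by grind)
  obtain ⟨m, hm, hmm, hwt'⟩ := h1.exists_extend hw (u := b) (by rw [h3]; rfl) (z := u)
      (by grind) hu.1
  refine Heavy.of_pair hl hm (by grind) ?_
  simp only [listWeight_singleton] at h4
  rw [hw.symm u b] at h
  linarith

/-- The two edges `uy`, `vx`. -/
lemma heavy_two (hw : IsWeight G w) (C : CutPair G S x y a b A D LA LD)
    (hu : u ∈ rest S x y a b A D) (hv : v ∈ rest S x y a b A D) (huv : u ≠ v)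
    (h : d ≤ w u y + w v x) : Heavy G w S x y d := by
  obtain ⟨f1, f2, -⟩ := C.facts
  rw [mem_rest] at hu hv
  obtain ⟨l, hl, hlm, hwt⟩ := (IsPathFrom.singleton f1.1).exists_extend hw (u := x) (z := v)
    rfl (by grind) hv.1
  obtain ⟨m, hm, hmm, hwt'⟩ := (IsPathFrom.singleton f1.2.1).exists_extend hw (u := y) (z := u)
    rfl (by grind) hu.1
  refine Heavy.of_pair hl hm (by grind) ?_
  rw [hw.symm u y, hw.symm v x] at h
  rw [hwt, hwt']; simpa using by linarith

/-- A path from `x` covering all vertices outside of the cuts. -/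
lemma outcome_of_path [Finite V] (hw : IsWeight G w) (C : CutPair G S x y a b A D LA LD)
    (hP : IsPathFrom G (insert x (rest S x y a b A D)) x P)
    (hc : ∀ v ∈ rest S x y a b A D, v ∈ P)
    (hd : ∀ v ∈ rest S x y a b A D, d ≤ degreeIn w S v) :
    Heavy G w S x y d ∨ SpanPair G S x y := by
  obtain ⟨f1, f2, f3, f4, f5, f6, f7⟩ := C.facts
  obtain ⟨P, u, hP, hc, hu, hwt⟩ := hP.exists_heavy hw (w := w) (by
    intro v hv
    rcases Finset.mem_insert.1 hv with rfl | hv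
    exacts [hP.head_mem, hc v hv])
  obtain ⟨p, rfl⟩ : ∃ p, P = x :: p := by
    cases P with
    | nil => simp at hu
    | cons c p => have := hP.head; simp at this; subst this; exact ⟨p, rfl⟩
  have hpx : x ∉ p := (List.nodup_cons.1 hP.nodup).1
  have hp : ∀ v, v ∈ p ↔ v ∈ rest S x y a b A D := by
    intro v
    constructor
    · intro hv
      have := hP.subset v (List.mem_cons_of_mem _ hv)
      rcases Finset.mem_insert.1 this with rfl | h
      exacts [absurd hv hpx, h]
    · intro hv
      have h1 := hc v (Finset.mem_insert_of_mem hv)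
      have h2 : v ≠ x := (mem_rest.1 hv).2.2.2.1
      simpa [h2] using h1
  cases p with
  | nil =>
    refine Or.inr (C.spanPair_of_right hw (Q := [b]) (IsPathFrom.singleton (by simp)) ?_)
    intro v hv; exact absurd ((hp v).2 hv) (by simp)
  | cons c p =>
    have hu' : (c :: p).getLast? = some u := by simpa using hu
    have hur : u ∈ rest S x y a b A D := (hp u).1 (List.mem_of_getLast? hu')
    have hcp : IsPathFrom G (rest S x y a b A D) c (c :: p) :=
      ⟨hP.chain.of_cons, hP.nodup.of_cons, fun v hv => (hp v).1 hv, rfl⟩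
    have hPS : IsPathFrom G S x (x :: c :: p) := hP.mono (by grind [mem_rest])
    have hrest : ∀ v ∈ x :: c :: p, v = x ∨ v ∈ rest S x y a b A D := by grind
    simp only [mem_rest] at hrest
    by_cases hub : G.Adj u b
    · refine Or.inr (C.spanPair_of_right hw (Q := b :: (c :: p).reverse)
        ((hcp.reverse hu').cons hub.symm (by simp only [List.mem_reverse, hp]; simp [mem_rest])
        (by simp) (fun v hv => Finset.mem_insert_of_mem ((hcp.reverse hu').subset v hv))) ?_)
      intro v hv
      have := (hp v).2 hv
      simp only [List.mem_cons, List.mem_reverse] at this ⊢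
      exact Or.inr this
    by_cases hua : a ≠ b ∧ G.Adj u a
    · right
      obtain ⟨hab, hua⟩ := hua
      obtain ⟨k, hk, hka⟩ := C.lastA
      have hA := C.coverA
      have hsub : ∀ v ∈ LA, v = x ∨ v ∈ A := fun v hv => by simpa using C.pathA.subset v hv
      have hLA := C.pathA
      obtain ⟨q, rfl⟩ : ∃ q, LA = x :: q := by
        cases LA with
        | nil => simp at hk
        | cons c p => have := hLA.head; simp at this; subst this; exact ⟨p, rfl⟩
      have hxq : x ∉ q := (List.nodup_cons.1 hLA.nodup).1
      have hqne : q ≠ [] := by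
        rintro rfl
        obtain ⟨t, ht⟩ := C.cutA.nonempty
        have := hA t ht
        grind
      obtain ⟨e, q, rfl⟩ := List.exists_cons_of_ne_nil hqne
      have hq : IsPathFrom G S e (e :: q) :=
        ⟨hLA.chain.of_cons, hLA.nodup.of_cons, fun v hv => by grind, rfl⟩
      have hk' : (e :: q).getLast? = some k := by simpa using hk
      have haq := (hq.reverse hk').cons hka.symm (x := a) (by grind) f1.2.2.1
        (hq.reverse hk').subset
      have hfin := hPS.append haq hu hua (by grind) (fun _ h => h) (fun _ h => h)
      obtain ⟨h1, h2, -⟩ := C.viaD hw (IsPathFrom.singleton f1.2.2.2) (m := [b]) (by grind)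
      refine ⟨_, _, hfin, h1, by grind, ?_⟩
      intro v hv
      have hD := C.coverD v
      have hy := C.pathD.head_mem
      have hr := hp v
      rw [mem_rest] at hr
      have hAv := hA v
      simp only [List.mem_append, List.mem_cons, List.mem_reverse] at *
      by_cases v = y
      · subst v; exact Or.inr (Or.inl hy)
      grind
    · left
      have h1 := hd u hur
      rw [C.degreeIn_eq hw hur, hw.eq_zero u b hub] at h1
      have h2 : (if a = b then 0 else w u a) = 0 := by
        split_ifs with hab
        · rfl
        · exact hw.eq_zero u a fun h => hua ⟨hab, h⟩
      rw [h2] at h1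
      rw [degreeIn, Finset.sum_insert (by simp [mem_rest])] at hwt
      have h3 : d ≤ listWeight w (x :: c :: p) + w u y := by rw [degreeIn] at h1; linarith
      by_cases huy : G.Adj u y
      · refine HeavyPath.heavy (hPS.append (IsPathFrom.singleton f1.2.1) hu huy (by grind)
          (fun _ h => h) (fun _ h => h))
          (by rw [List.getLast?_append_of_ne_nil _ (by simp)]; rfl) ?_
        rw [listWeight_append w hu (v := y) rfl]
        simpa using h3
      · rw [hw.eq_zero u y huy] at h3
        exact Heavy.of_pair hPS (IsPathFrom.singleton f1.2.1) (by grind) (by simpa using h3)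

/-- A path pair with start vertices `x` and `b` covering all vertices outside of the cuts. -/
theorem outcome_of_pathPair [Finite V] (hw : IsWeight G w) (C : CutPair G S x y a b A D LA LD)
    (h : IsPathPair G (insert x (insert b (rest S x y a b A D))) x b P Q)
    (hd : ∀ v ∈ rest S x y a b A D, d ≤ degreeIn w S v) :
    Heavy G w S x y d ∨ SpanPair G S x y := by
  obtain ⟨f1, f2, f3, f4, f5, f6, f7⟩ := C.facts
  by_cases hno : HamPath G (insert x (insert b (rest S x y a b A D))) x b
  · obtain ⟨l, hl, hlb, hc⟩ := hno
    have hrev := hl.reverse hlb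
    have hne : l.dropLast ≠ [] := by
      intro h0
      have h1 := List.dropLast_append_getLast? b hlb
      rw [h0] at h1
      have := hl.head
      rw [← h1] at this
      simp at this
      exact f2.2.2.2.1 this
    have hl' : l = l.dropLast ++ [b] := (List.dropLast_append_getLast? b hlb).symm
    obtain ⟨h1, -, h3⟩ := (hl' ▸ hl).split hne
    refine C.outcome_of_path hw (P := l.dropLast) (h1.mono ?_) ?_ hd
    · intro v hv
      have := h1.subset v hv
      have := h3 v hv
      grind
    · intro v hv
      have h4 := hc v (by simp [hv])
      rw [hl', List.mem_append] at h4
      rcases h4 with h4 | h4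
      · exact h4
      · have := (mem_rest.1 hv).2.2.2.2.2.2
        simp [this] at h4
  obtain ⟨P, Q, u, v, h, hu, hv, hwt⟩ := h.exists_heavy hw (w := w) hno
  have hbP : b ∉ P := fun hb => h.disjoint b hb h.right.head_mem
  have hxQ : x ∉ Q := h.disjoint x h.left.head_mem
  have hP : ∀ t ∈ P, t = x ∨ t ∈ rest S x y a b A D := by
    intro t ht; have := h.left.subset t ht; grind
  have hQ : ∀ t ∈ Q, t = b ∨ t ∈ rest S x y a b A D := by
    intro t ht; have := h.right.subset t ht; grind
  have hlone : ∀ (L : List V) (s : V), L.head? = some s → L.getLast? = some s → L.Nodup →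
      L = [s] := by
    intro L s h1 h2 h3
    cases L with
    | nil => simp at h1
    | cons c L =>
      simp at h1; subst h1
      cases L with
      | nil => rfl
      | cons e L =>
        have : c ∈ e :: L := List.mem_of_getLast? (by simpa using h2)
        exact absurd this (List.nodup_cons.1 h3).1
  rcases hP u (List.mem_of_getLast? hu) with rfl | hur
  · have := hlone P u h.left.head hu h.left.nodup
    subst this
    refine Or.inr (C.spanPair_of_right hw (Q := Q) (h.right.mono (by grind)) ?_)
    intro t ht
    have h1 := h.cover t (by simp [ht])
    have h2 := mem_rest.1 ht
    grind
  rcases hQ v (List.mem_of_getLast? hv) with rfl | hvr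
  · have := hlone Q v h.right.head hv h.right.nodup
    subst this
    refine C.outcome_of_path hw (P := P) (h.left.mono (by grind)) ?_ hd
    intro t ht
    have h1 := h.cover t (by simp [ht])
    have h2 := mem_rest.1 ht
    grind
  left
  have huv : u ≠ v := fun huv =>
    h.disjoint u (List.mem_of_getLast? hu) (huv ▸ List.mem_of_getLast? hv)
  have hPS : IsPathFrom G S x P := h.left.mono (by grind [mem_rest])
  have hQS : IsPathFrom G S b Q := h.right.mono (by grind [mem_rest])
  have h1 := hd u hur
  have h2 := hd v hvr
  rw [C.degreeIn_eq hw hur] at h1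
  rw [C.degreeIn_eq hw hvr] at h2
  rw [degreeIn, degreeIn, Finset.sum_insert (by simp [mem_rest, f2.2.2.2.1.symm]),
    Finset.sum_insert (by simp [mem_rest]), Finset.sum_insert (by simp [mem_rest, f2.2.2.2.1.symm]),
    Finset.sum_insert (by simp [mem_rest])] at hwt
  rw [degreeIn] at h1 h2
  simp only [mem_rest] at hP hQ
  by_cases hab : a = b
  · rw [if_pos hab] at h1 h2
    by_cases hW : d ≤ listWeight w P + listWeight w Q + w u b + w v y
    · exact C.heavy_join hw hPS hQS h.disjoint (by grind) (by grind) hu hv hW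
    · exact C.heavy_two hw hur hvr huv (by linarith)
  rw [if_neg hab] at h1 h2
  by_cases huy : G.Adj u y
  · by_cases hW : d ≤ listWeight w P + listWeight w Q + w u b + w v y
    · exact C.heavy_join hw hPS hQS h.disjoint (by grind) (by grind) hu hv hW
    · exact C.heavy_four_of_adj hw hur hvr huv huy (by linarith)
  · rw [hw.eq_zero u y huy] at h1
    by_cases hW : d ≤ listWeight w P + listWeight w Q + w u a + w v y
    · exact C.heavy_extend hw hPS hQS h.disjoint (by grind) (by grind) hu hv hW
    · exact C.heavy_three hw hab hur hvr huv (by linarith)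

end CutPair

end WGraph

namespace WGraph

variable {V : Type*} {G : SimpleGraph V} {w : V → V → ℝ} {S T Z : Finset V}
  {x y z a b c u v : V} {d : ℝ} {l m s t P Q LA LD : List V}

lemma listWeight_mono {w w' : V → V → ℝ} (h : ∀ u v, w u v ≤ w' u v) (l : List V) :
    listWeight w l ≤ listWeight w' l := by
  induction l with
  | nil => simp
  | cons a l ih =>
    cases l with
    | nil => simp
    | cons b l => simpa using add_le_add (h a b) ih

/-- The graph `G[Z]` together with the edges `xa` and `yb` and the triangle `abc`. -/
def gateGraph (G : SimpleGraph V) (Z : Finset V) (x y a b c : V) : SimpleGraph V where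
  Adj u v := u ≠ v ∧ ((G.Adj u v ∧ u ∈ Z ∧ v ∈ Z) ∨ s(u, v) = s(x, a) ∨ s(u, v) = s(y, b) ∨
    s(u, v) = s(a, b) ∨ s(u, v) = s(a, c) ∨ s(u, v) = s(b, c))
  symm := ⟨fun u v h => by
    rw [Sym2.eq_swap (a := v) (b := u), G.adj_comm v u]
    exact ⟨h.1.symm, h.2.imp_left fun h => ⟨h.1, h.2.2, h.2.1⟩⟩⟩
  loopless := ⟨fun u h => h.1 rfl⟩

lemma gateGraph_adj : (gateGraph G Z x y a b c).Adj u v ↔ u ≠ v ∧ ((G.Adj u v ∧ u ∈ Z ∧ v ∈ Z) ∨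
    s(u, v) = s(x, a) ∨ s(u, v) = s(y, b) ∨ s(u, v) = s(a, b) ∨ s(u, v) = s(a, c) ∨
    s(u, v) = s(b, c)) := Iff.rfl

/-- The terminals of `gateGraph`. -/
lemma mem_terminals {r : V} (h : s(u, v) = s(x, a) ∨ s(u, v) = s(y, b) ∨
    s(u, v) = s(a, b) ∨ s(u, v) = s(a, c) ∨ s(u, v) = s(b, c)) (hr : r = u ∨ r = v) :
    r = x ∨ r = y ∨ r = a ∨ r = b ∨ r = c := by
  simp only [Sym2.eq_iff] at h; grind

/-- A path of the gate graph that avoids `c` and one of `a` and `b`. -/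
lemma isChain_of_gate (hl : l.IsChain (gateGraph G Z x y a b c).Adj) (hc : c ∉ l)
    (hab : ¬ (a ∈ l ∧ b ∈ l)) :
    l.IsChain fun u v => G.Adj u v ∨ s(u, v) = s(y, b) ∨ s(u, v) = s(x, a) := by
  refine List.IsChain.imp_of_mem_imp (fun u v hu hv huv => ?_) hl
  rw [gateGraph_adj] at huv
  simp only [Sym2.eq_iff] at huv ⊢
  grind

variable [DecidableEq V] {A D : Finset V}

/-- The weights of `G[Z]`; all other pairs have weight zero. -/
def restrictWeight (w : V → V → ℝ) (Z : Finset V) (u v : V) : ℝ :=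
  if u ∈ Z ∧ v ∈ Z then w u v else 0

lemma restrictWeight_le (hw : IsWeight G w) (u v : V) : restrictWeight w Z u v ≤ w u v := by
  unfold restrictWeight
  split_ifs
  exacts [le_rfl, hw.nonneg u v]

lemma isWeight_restrictWeight (hw : IsWeight G w) :
    IsWeight (gateGraph G Z x y a b c) (restrictWeight w Z) where
  symm u v := by simp only [restrictWeight, hw.symm u v, and_comm]
  nonneg u v := by
    unfold restrictWeight
    split_ifs
    exacts [hw.nonneg u v, le_rfl]
  eq_zero u v h := by
    unfold restrictWeight
    split_ifs with hZ
    · refine hw.eq_zero u v fun huv => h (gateGraph_adj.2 ⟨huv.ne, Or.inl ⟨huv, hZ⟩⟩)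
    · rfl

namespace CutPair

lemma replace_first (hw : IsWeight G w) (C : CutPair G S x y a b A D LA LD)
    {R R₀ : V → V → Prop} (hR : ∀ u v, R u v → R₀ u v ∨ s(u, v) = s(x, a))
    (hG : ∀ u v, G.Adj u v → R₀ u v) (hl : l.IsChain R) (hn : l.Nodup) (hx : l.head? = some x)
    (hA : ∀ v ∈ l, v ∉ A) :
    ∃ l', l'.IsChain R₀ ∧ l'.Nodup ∧ l'.head? = some x ∧ l'.getLast? = l.getLast? ∧
      (∀ v ∈ l', v ∈ l ∨ v ∈ A) ∧ listWeight w l ≤ listWeight w l' := by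
  obtain ⟨p, rfl⟩ : ∃ p, l = x :: p := by
    cases l with
    | nil => simp at hx
    | cons c p => simp at hx; subst hx; exact ⟨p, rfl⟩
  have hxp : x ∉ p := (List.nodup_cons.1 hn).1
  have hp : p.IsChain R₀ := by
    refine List.IsChain.imp_of_mem_imp (fun u v hu hv huv => ?_) hl.tail
    rcases hR u v huv with h | h
    · exact h
    · simp only [Sym2.eq_iff] at h
      grind
  cases p with
  | nil => exact ⟨[x], by simp, by simp, rfl, rfl, by simp, le_rfl⟩
  | cons e p =>
    by_cases hxe : R₀ x e
    · exact ⟨x :: e :: p, List.isChain_cons_cons.2 ⟨hxe, hp⟩, hn, rfl, rfl,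
        fun v hv => Or.inl hv, le_rfl⟩
    · have he : e = a := by
        have h := (hR x e hl.rel).resolve_left hxe
        have := C.cutA.ne
        simp only [Sym2.eq_iff] at h
        grind
      subst he
      obtain ⟨k, hk, hke⟩ := C.lastA
      have hsub : ∀ v ∈ LA, v = x ∨ v ∈ A := fun v hv => by simpa using C.pathA.subset v hv
      refine ⟨LA ++ e :: p, ?_, ?_, ?_, ?_, ?_, ?_⟩
      · rw [List.isChain_append]
        refine ⟨C.pathA.chain.imp hG, hp, fun r hr t ht => ?_⟩
        rw [hk] at hr
        simp at hr ht
        subst hr ht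
        exact hG _ _ hke
      · rw [List.nodup_append]
        refine ⟨C.pathA.nodup, (List.nodup_cons.1 hn).2, fun r hr t ht hrt => ?_⟩
        subst hrt
        rcases hsub r hr with rfl | h
        · exact hxp ht
        · exact hA r (List.mem_cons_of_mem _ ht) h
      · rw [List.head?_append, C.pathA.head]; rfl
      · rw [List.getLast?_append_of_ne_nil _ (by simp)]; simp
      · intro v hv
        rcases List.mem_append.1 hv with hv | hv
        · rcases hsub v hv with rfl | h
          · simp
          · exact Or.inr h
        · exact Or.inl (List.mem_cons_of_mem _ hv)
      · rw [listWeight_cons_cons, hw.eq_zero x e (fun h => hxe (hG _ _ h)),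
          listWeight_append w hk (v := e) rfl]
        have := hw.nonneg k e
        have := listWeight_nonneg hw.nonneg LA
        linarith

/-- A path that may use `xa` and `yb` as edges yields a path of `G` that is no lighter. -/
lemma heavyPath_of_virtual (hw : IsWeight G w) (C : CutPair G S x y a b A D LA LD)
    (hl : l.IsChain fun u v => G.Adj u v ∨ s(u, v) = s(y, b) ∨ s(u, v) = s(x, a)) (hn : l.Nodup)
    (hx : l.head? = some x) (hy : l.getLast? = some y) (hZ : ∀ v ∈ l, v ∈ S ∧ v ∉ A ∧ v ∉ D)
    (h : d ≤ listWeight w l) : Heavy G w S x y d := by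
  obtain ⟨f1, f2, f3, f4, f5, f6, f7⟩ := C.facts
  obtain ⟨l₁, h1, h2, h3, h4, h5, h6⟩ := C.replace_first hw
    (R₀ := fun u v => G.Adj u v ∨ s(u, v) = s(y, b)) (fun u v h => by tauto)
    (fun u v h => Or.inl h) hl hn hx (by grind)
  obtain ⟨l₂, g1, g2, g3, g4, g5, g6⟩ := C.symm.replace_first hw (l := l₁.reverse)
    (R := fun u v => G.Adj u v ∨ s(u, v) = s(y, b)) (R₀ := G.Adj) (fun u v h => h)
    (fun u v h => h) (by
      rw [List.isChain_reverse]
      exact h1.imp fun u v h => by rwa [G.adj_comm v u, Sym2.eq_swap]) (by simpa) (by simp [h4, hy])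
    (by simp only [List.mem_reverse]; grind)
  refine Heavy.symm hw (HeavyPath.heavy (l := l₂) ⟨g1, g2, ?_, g3⟩ (by simp [g4, h3]) ?_)
  · simp only [List.mem_reverse] at g5; grind
  · rw [listWeight_reverse w hw.symm] at g6; linarith

/-- A pair of paths that may use `xa` and `yb` as edges yields a pair of paths of `G` that is no
lighter. -/
lemma heavyPair_of_virtual (hw : IsWeight G w) (C : CutPair G S x y a b A D LA LD)
    (hl : l.IsChain fun u v => G.Adj u v ∨ s(u, v) = s(y, b) ∨ s(u, v) = s(x, a))
    (hm : m.IsChain fun u v => G.Adj u v ∨ s(u, v) = s(y, b) ∨ s(u, v) = s(x, a))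
    (hnl : l.Nodup) (hnm : m.Nodup) (hx : l.head? = some x) (hy : m.head? = some y)
    (hd : ∀ v ∈ l, v ∉ m)
    (hZl : ∀ v ∈ l, v ∈ S ∧ v ∉ A ∧ v ∉ D) (hZm : ∀ v ∈ m, v ∈ S ∧ v ∉ A ∧ v ∉ D)
    (h : d ≤ listWeight w l + listWeight w m) : Heavy G w S x y d := by
  obtain ⟨f1, f2, f3, f4, f5, f6, f7⟩ := C.facts
  have hyl : y ∉ l := fun h => hd y h (List.mem_of_head? hy)
  have hxm : x ∉ m := hd x (List.mem_of_head? hx)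
  obtain ⟨l₁, h1, h2, h3, -, h5, h6⟩ := C.replace_first hw
    (R := fun u v => G.Adj u v ∨ s(u, v) = s(x, a)) (R₀ := G.Adj) (fun u v h => h)
    (fun u v h => h) (List.IsChain.imp_of_mem_imp (fun u v hu hv huv => by
      simp only [Sym2.eq_iff] at huv ⊢; grind) hl) hnl hx (by grind)
  obtain ⟨l₂, g1, g2, g3, -, g5, g6⟩ := C.symm.replace_first hw
    (R := fun u v => G.Adj u v ∨ s(u, v) = s(y, b)) (R₀ := G.Adj) (fun u v h => h)
    (fun u v h => h) (List.IsChain.imp_of_mem_imp (fun u v hu hv huv => by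
      simp only [Sym2.eq_iff] at huv ⊢; grind) hm) hnm hy (by grind)
  exact Heavy.of_pair ⟨h1, h2, by grind, h3⟩ ⟨g1, g2, by grind, g3⟩ (by grind) (by linarith)

/-- Paths of the gate graph with at most one terminal are paths of `G`. -/
lemma isPathFrom_of_gate {g : V} (hcA : c ∈ A)
    (hl : IsPathFrom (gateGraph G Z x y a b c) T z l)
    (hg : ∀ v ∈ l, v = g ∨ v ∈ rest S x y a b A D) :
    IsPathFrom G (insert g (rest S x y a b A D)) z l := by
  refine ⟨List.IsChain.imp_of_mem_imp (fun u v hu hv huv => ?_) hl.chain, hl.nodup,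
    fun v hv => by simpa using hg v hv, hl.head⟩
  rw [gateGraph_adj] at huv
  rcases huv.2 with h | h
  · exact h.1
  · have h1 := mem_terminals h (Or.inl rfl)
    have h2 := mem_terminals h (Or.inr rfl)
    have h3 := hg u hu
    have h4 := hg v hv
    simp only [mem_rest] at h3 h4
    grind

lemma mem_side : v ∈ S \ (A ∪ D) ↔ v ∈ S ∧ v ∉ A ∧ v ∉ D := by
  simp [not_or]

/-- A heavy path of the gate graph that is cut at the gate. -/
lemma heavy_of_gate_split (hw : IsWeight G w) (C : CutPair G S x y a b A D LA LD) (hcA : c ∈ A)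
    {g h : V} (hgh : g = a ∧ h = b ∨ g = b ∧ h = a)
    (hs : s.IsChain (gateGraph G (S \ (A ∪ D)) x y a b c).Adj)
    (ht : t.IsChain (gateGraph G (S \ (A ∪ D)) x y a b c).Adj)
    (hn : (s ++ t).Nodup) (hx : s.head? = some x) (hy : t.getLast? = some y)
    (hg : g ∈ s) (hh : h ∈ t) (hZ : ∀ v ∈ s ++ t, v ∈ S ∧ v ∉ A ∧ v ∉ D)
    (hwt : d ≤ listWeight w s + listWeight w t) : Heavy G w S x y d := by
  obtain ⟨hns, hnt, hd⟩ := List.nodup_append.1 hn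
  simp only [List.mem_append] at hZ
  refine C.heavyPair_of_virtual hw (l := s) (m := t.reverse) (isChain_of_gate hs ?_ ?_) ?_ hns
    (by simpa) hx (by simpa) ?_ (fun v hv => hZ v (Or.inl hv))
    (fun v hv => hZ v (Or.inr (by simpa using hv))) ?_
  · grind
  · grind
  · rw [List.isChain_reverse]
    refine (isChain_of_gate ht ?_ ?_).imp fun u v h => ?_
    · grind
    · grind
    · rwa [G.adj_comm v u, Sym2.eq_swap]
  · simp only [List.mem_reverse]; grind
  · rwa [listWeight_reverse w hw.symm]

end CutPair

end WGraph

namespace WGraph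

variable {V : Type*} [DecidableEq V] {G : SimpleGraph V} {w : V → V → ℝ} {S T Z : Finset V}
  {x y z a b c u v : V} {d : ℝ} {l m s t P Q LA LD : List V} {A D : Finset V}

/-- The vertices of the gate graph: those outside of the cuts, and `c` if there is a gate. -/
def gateSet (S : Finset V) (a b c : V) (A D : Finset V) : Finset V :=
  if a = b then S \ (A ∪ D) else insert c (S \ (A ∪ D))

lemma mem_gateSet : v ∈ gateSet S a b c A D ↔ (v ∈ S ∧ v ∉ A ∧ v ∉ D) ∨ (a ≠ b ∧ v = c) := by
  unfold gateSet
  split_ifs with h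
  · rw [CutPair.mem_side]; simp [h]
  · rw [Finset.mem_insert, CutPair.mem_side]; simp only [ne_eq, h]; tauto

namespace CutPair

lemma linked_gate (C : CutPair G S x y a b A D LA LD) (hcA : c ∈ A) :
    Linked (gateGraph G (S \ (A ∪ D)) x y a b c) (gateSet S a b c A D) x y := by
  obtain ⟨f1, f2, f3, f4, f5, f6, f7⟩ := C.facts
  refine ⟨by grind [mem_gateSet], by grind [mem_gateSet], f2.1, fun X hX hne hx hy k => ?_⟩
  have hX' : ∀ v ∈ X, (v ∈ S ∧ v ∉ A ∧ v ∉ D) ∨ (a ≠ b ∧ v = c) := fun v hv =>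
    mem_gateSet.1 (hX hv)
  have edge : ∀ v u, v ∈ X → u ∈ gateSet S a b c A D → u ∉ X → u ≠ k →
      (s(v, u) = s(x, a) ∨ s(v, u) = s(y, b) ∨ s(v, u) = s(a, b) ∨ s(v, u) = s(a, c) ∨
        s(v, u) = s(b, c)) → ∃ v ∈ X, ∃ u ∈ gateSet S a b c A D, u ∉ X ∧ u ≠ k ∧
        (gateGraph G (S \ (A ∪ D)) x y a b c).Adj v u := fun v u hv hu huX huk h =>
    ⟨v, hv, u, hu, huX, huk, gateGraph_adj.2 ⟨fun h => huX (h ▸ hv), Or.inr h⟩⟩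
  simp only [Sym2.eq_iff] at edge
  by_cases ha : a ∈ X
  · by_cases hk : k = x
    · by_cases hb : b ∈ X
      · exact edge b y hb (by grind [mem_gateSet]) hy (by grind) (by grind)
      · exact edge a b ha (by grind [mem_gateSet]) hb (by grind) (by grind)
    · exact edge a x ha (by grind [mem_gateSet]) hx (by grind) (by grind)
  by_cases hb : b ∈ X
  · by_cases hk : k = y
    · exact edge b a hb (by grind [mem_gateSet]) ha (by grind) (by grind)
    · exact edge b y hb (by grind [mem_gateSet]) hy (by grind) (by grind)
  by_cases hc : c ∈ X
  · by_cases hk : k = a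
    · exact edge c b hc (by grind [mem_gateSet]) hb (by grind) (by grind)
    · exact edge c a hc (by grind [mem_gateSet]) ha (by grind) (by grind)
  have hXr : ∀ v ∈ X, v ∈ S ∧ v ∉ A ∧ v ∉ D := by grind
  obtain ⟨v, hv, u, hu, huX, huk, hvu⟩ := C.linked.expand X (fun v hv => (hXr v hv).1) hne hx hy k
  have h1 := hXr v hv
  have huA : u ∉ A := fun h => by
    have := C.cutA.closed u h v h1.1 h1.2.1 hvu.symm
    grind
  have huD : u ∉ D := fun h => by
    have := C.cutD.closed u h v h1.1 h1.2.2 hvu.symm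
    grind
  exact ⟨v, hv, u, mem_gateSet.2 (Or.inl ⟨hu, huA, huD⟩), huX, huk, gateGraph_adj.2
    ⟨hvu.ne, Or.inl ⟨hvu, mem_side.2 h1, mem_side.2 ⟨hu, huA, huD⟩⟩⟩⟩

lemma degreeIn_gate (hw : IsWeight G w) (C : CutPair G S x y a b A D LA LD)
    (hv : v ∈ rest S x y a b A D) :
    degreeIn (restrictWeight w (S \ (A ∪ D))) (gateSet S a b c A D) v = degreeIn w S v := by
  have hvr := mem_rest.1 hv
  have hvZ : v ∈ S \ (A ∪ D) := mem_side.2 ⟨hvr.1, hvr.2.1, hvr.2.2.1⟩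
  have h1 : degreeIn (restrictWeight w (S \ (A ∪ D))) (gateSet S a b c A D) v =
      degreeIn (restrictWeight w (S \ (A ∪ D))) (S \ (A ∪ D)) v := by
    refine (Finset.sum_subset (fun u hu => mem_gateSet.2 (Or.inl (mem_side.1 hu)))
      fun u _ hu => ?_).symm
    simp only [restrictWeight, hu, and_false, if_false]
  have h2 : degreeIn (restrictWeight w (S \ (A ∪ D))) (S \ (A ∪ D)) v =
      degreeIn w (S \ (A ∪ D)) v :=
    Finset.sum_congr rfl fun u hu => by simp only [restrictWeight, hu, hvZ, and_self, if_true]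
  rw [h1, h2]
  refine Finset.sum_subset Finset.sdiff_subset fun u hu hun => hw.eq_zero _ _ fun hvu => ?_
  rw [mem_side] at hun
  by_cases huA : u ∈ A
  · have := C.cutA.closed u huA v hvr.1 hvr.2.1 hvu.symm
    tauto
  · have huD : u ∈ D := by tauto
    have := C.cutD.closed u huD v hvr.1 hvr.2.2.1 hvu.symm
    tauto

/-- In the gate graph, `c` is adjacent to `a` and `b` only. -/
lemma gate_adj (C : CutPair G S x y a b A D LA LD) (hcA : c ∈ A)
    (h : (gateGraph G (S \ (A ∪ D)) x y a b c).Adj u c) : u = a ∨ u = b := by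
  obtain ⟨f1, f2, f3, f4, f5, f6, f7⟩ := C.facts
  rw [gateGraph_adj, mem_side, mem_side] at h
  simp only [Sym2.eq_iff] at h
  grind

lemma restrictWeight_gate (hcA : c ∈ A) (u : V) :
    restrictWeight w (S \ (A ∪ D)) u c = 0 := by
  simp [restrictWeight, hcA]

/-- The parts of a path of the gate graph on both sides of `c`. -/
lemma gate_split (C : CutPair G S x y a b A D LA LD) (hcA : c ∈ A)
    (hl : IsPathFrom (gateGraph G (S \ (A ∪ D)) x y a b c) (gateSet S a b c A D) x (s ++ c :: t))
    (hy : (s ++ c :: t).getLast? = some y) :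
    ∃ g h, (g = a ∧ h = b ∨ g = b ∧ h = a) ∧ s.head? = some x ∧ s.getLast? = some g ∧
      t.head? = some h ∧ t.getLast? = some y := by
  obtain ⟨f1, f2, f3, f4, f5, f6, f7⟩ := C.facts
  have hs : s ≠ [] := by
    rintro rfl
    have := hl.head
    simp at this
    grind
  have ht : t ≠ [] := by
    rintro rfl
    simp at hy
    grind
  obtain ⟨h1, h2, h3⟩ := hl.split hs
  obtain ⟨g, hg⟩ := h1.exists_getLast?
  obtain ⟨h, t, rfl⟩ := List.exists_cons_of_ne_nil ht
  have hgc : (gateGraph G (S \ (A ∪ D)) x y a b c).Adj g c :=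
    (List.isChain_append.1 hl.chain).2.2 g hg c rfl
  have hch := (h2.chain.rel).symm
  have hgh : g ≠ h := fun hgh => h3 g (List.mem_of_getLast? hg) (by simp [hgh])
  refine ⟨g, h, ?_, h1.head, hg, rfl, ?_⟩
  · have := C.gate_adj hcA hgc
    have := C.gate_adj hcA hch
    grind
  · rw [List.getLast?_append_of_ne_nil _ (by simp)] at hy
    simpa using hy

/-- A heavy path of the gate graph. -/
lemma heavy_of_gate (hw : IsWeight G w) (C : CutPair G S x y a b A D LA LD) (hcA : c ∈ A)
    (h : HeavyPath (gateGraph G (S \ (A ∪ D)) x y a b c) (restrictWeight w (S \ (A ∪ D)))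
      (gateSet S a b c A D) x y d) : Heavy G w S x y d := by
  obtain ⟨f1, f2, f3, f4, f5, f6, f7⟩ := C.facts
  obtain ⟨l, hl, hy, hd⟩ := h
  have hlZ : ∀ v ∈ l, v ≠ c → v ∈ S ∧ v ∉ A ∧ v ∉ D := fun v hv hvc => by
    have := mem_gateSet.1 (hl.subset v hv)
    tauto
  have hle := fun l => listWeight_mono (restrictWeight_le (Z := S \ (A ∪ D)) hw) l
  by_cases hcl : c ∈ l
  · obtain ⟨s, t, rfl⟩ := List.append_of_mem hcl
    obtain ⟨g, h, hgh, hsx, hsg, hth, hty⟩ := C.gate_split hcA hl hy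
    have hn := hl.nodup
    have hst : (s ++ t).Nodup := hn.sublist (by simp)
    have hcst : c ∉ s ++ t := by
      have := List.nodup_middle.1 hn
      exact (List.nodup_cons.1 this).1
    refine C.heavy_of_gate_split hw hcA hgh hl.chain.left_of_append
      (hl.chain.right_of_append).tail hst hsx hty (List.mem_of_getLast? hsg)
      (List.mem_of_head? hth) (by grind) ?_
    rw [listWeight_append _ hsg (v := c) rfl, listWeight_cons _ hth, restrictWeight_gate hcA,
      (isWeight_restrictWeight hw (x := x) (y := y) (a := a) (b := b) (c := c)).symm c h,
      restrictWeight_gate hcA] at hd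
    have := hle s
    have := hle t
    rw [List.tail_cons]
    linarith
  · have hlZ' : ∀ v ∈ l, v ∈ S ∧ v ∉ A ∧ v ∉ D := fun v hv => hlZ v hv fun h => hcl (h ▸ hv)
    by_cases hch : l.IsChain fun u v => G.Adj u v ∨ s(u, v) = s(y, b) ∨ s(u, v) = s(x, a)
    · exact C.heavyPath_of_virtual hw hch hl.nodup hl.head hy hlZ' (hd.trans (hle l))
    · obtain ⟨s, t, g, h, rfl, hgh⟩ := exists_not_rel_of_not_isChain hch
      have hl' : s ++ g :: h :: t = (s ++ [g]) ++ (h :: t) := by simp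
      rw [hl'] at hl hy hlZ' hd hcl
      obtain ⟨h1, h2, h3⟩ := hl.split (by simp)
      have hgl : (s ++ [g]).getLast? = some g := by simp
      have hadj : (gateGraph G (S \ (A ∪ D)) x y a b c).Adj g h :=
        (List.isChain_append.1 hl.chain).2.2 g hgl h rfl
      have hgh' : g = a ∧ h = b ∨ g = b ∧ h = a := by
        rw [gateGraph_adj] at hadj
        simp only [Sym2.eq_iff] at hadj hgh
        grind
      refine C.heavy_of_gate_split hw hcA hgh' h1.chain h2.chain hl.nodup h1.head ?_
        (by simp) (by simp) hlZ' ?_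
      · rwa [List.getLast?_append_of_ne_nil _ (by simp)] at hy
      · rw [listWeight_append _ hgl (v := h) rfl] at hd
        have h0 := restrictWeight_le (Z := S \ (A ∪ D)) hw g h
        rw [hw.eq_zero g h fun h => hgh (Or.inl h)] at h0
        linarith [hle (s ++ [g]), hle (h :: t)]

/-- The two sides of the gate, with the terminals `x` and `y` on their outer ends. -/
lemma outcome_of_sides [Finite V] (hw : IsWeight G w) (C : CutPair G S x y a b A D LA LD)
    (hcA : c ∈ A) (hP : IsPathFrom (gateGraph G (S \ (A ∪ D)) x y a b c) T x P)
    (hQ : IsPathFrom (gateGraph G (S \ (A ∪ D)) x y a b c) T b Q)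
    (hPr : ∀ v ∈ P, v = x ∨ v ∈ rest S x y a b A D)
    (hQr : ∀ v ∈ Q, v = b ∨ v ∈ rest S x y a b A D)
    (hdis : ∀ v ∈ P, v ∉ Q) (hc : ∀ v ∈ rest S x y a b A D, v ∈ P ∨ v ∈ Q)
    (hd : ∀ v ∈ rest S x y a b A D, d ≤ degreeIn w S v) :
    Heavy G w S x y d ∨ SpanPair G S x y := by
  have hP' := isPathFrom_of_gate hcA hP hPr
  have hQ' := isPathFrom_of_gate hcA hQ hQr
  have hx := hP.head_mem
  have hb := hQ.head_mem
  exact C.outcome_of_pathPair hw ⟨hP'.mono (by grind), hQ'.mono (by grind), hdis, by grind⟩ hd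

/-- A Hamiltonian path of the gate graph. -/
lemma outcome_of_gate [Finite V] (hw : IsWeight G w) (C : CutPair G S x y a b A D LA LD)
    (hcA : c ∈ A)
    (h : HamPath (gateGraph G (S \ (A ∪ D)) x y a b c) (gateSet S a b c A D) x y)
    (hd : ∀ v ∈ rest S x y a b A D, d ≤ degreeIn w S v) :
    Heavy G w S x y d ∨ SpanPair G S x y := by
  obtain ⟨f1, f2, f3, f4, f5, f6, f7⟩ := C.facts
  obtain ⟨l, hl, hy, hcov⟩ := h
  have hrest : ∀ v, (v ∈ S ∧ v ∉ A ∧ v ∉ D) →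
      v = x ∨ v = y ∨ v = a ∨ v = b ∨ v ∈ rest S x y a b A D := fun v hv => by
    rw [mem_rest]; tauto
  have hcov' : ∀ v ∈ rest S x y a b A D, v ∈ l := fun v hv => by
    rw [mem_rest] at hv
    exact hcov v (mem_gateSet.2 (Or.inl ⟨hv.1, hv.2.1, hv.2.2.1⟩))
  have hsub : ∀ v ∈ l, v ≠ c → v = x ∨ v = y ∨ v = a ∨ v = b ∨ v ∈ rest S x y a b A D :=
    fun v hv hvc => hrest v (by have := mem_gateSet.1 (hl.subset v hv); tauto)
  by_cases hab : a = b
  · have hcl : c ∉ l := fun h => by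
      have := mem_gateSet.1 (hl.subset c h)
      tauto
    have hbl : b ∈ l := hcov b (mem_gateSet.2 (Or.inl ⟨f1.2.2.2, f3.2.2.2, f4.2.2.2⟩))
    obtain ⟨s, t, rfl⟩ := List.append_of_mem hbl
    have hs : s ≠ [] := by
      rintro rfl
      have := hl.head
      simp at this
      grind
    obtain ⟨h1, h2, h3⟩ := hl.split hs
    have hty : (b :: t).getLast? = some y := by
      rwa [List.getLast?_append_of_ne_nil _ (by simp)] at hy
    have hyb := notMem_dropLast h2.nodup hty
    have hx := h1.head_mem
    have hyt := List.mem_of_getLast? hty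
    have hQ := h2.dropLast hty f2.2.2.2.2
    have hdl : ∀ v, v ∈ b :: t ↔ v ∈ (b :: t).dropLast ∨ v = y := fun v => by
      conv_lhs => rw [← List.dropLast_append_getLast? y hty]
      simp
    have hb := hQ.head_mem
    refine C.outcome_of_sides hw hcA h1 hQ ?_ ?_ ?_ ?_ hd
    · intro v hv
      have hvl : v ∈ s ++ b :: t := by simp [hv]
      have := hsub v hvl fun h => hcl (h ▸ hvl)
      grind
    · intro v hv
      have hvl : v ∈ s ++ b :: t := List.mem_append_right _ ((hdl v).2 (Or.inl hv))
      have := hsub v hvl fun h => hcl (h ▸ hvl)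
      grind
    · grind
    · intro v hv
      have := hcov' v hv
      rw [List.mem_append, hdl] at this
      have := mem_rest.1 hv
      tauto
  · have hcl : c ∈ l := hcov c (mem_gateSet.2 (Or.inr ⟨hab, rfl⟩))
    obtain ⟨s, t, rfl⟩ := List.append_of_mem hcl
    obtain ⟨g, h, hgh, hsx, hsg, hth, hty⟩ := C.gate_split hcA hl hy
    have hs : s ≠ [] := by rintro rfl; simp at hsx
    obtain ⟨h1, h2, h3⟩ := hl.split hs
    have h2' : IsPathFrom (gateGraph G (S \ (A ∪ D)) x y a b c) (gateSet S a b c A D) h t :=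
      ⟨h2.chain.tail, h2.nodup.of_cons, fun v hv => h2.subset v (by simp [hv]), hth⟩
    have hct : c ∉ t := (List.nodup_cons.1 h2.nodup).1
    have hgs := List.mem_of_getLast? hsg
    have hht := List.mem_of_head? hth
    have hxs := List.mem_of_head? hsx
    have hyt := List.mem_of_getLast? hty
    have hQ := h2'.dropLast hty (by grind)
    have hyd := notMem_dropLast h2'.nodup hty
    have hdt : ∀ v, v ∈ t ↔ v ∈ t.dropLast ∨ v = y := fun v => by
      conv_lhs => rw [← List.dropLast_append_getLast? y hty]
      simp
    have hsubs : ∀ v ∈ s, v = x ∨ v = g ∨ v ∈ rest S x y a b A D := fun v hv => by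
      have := hsub v (by simp [hv]) fun h => h3 v hv (h ▸ List.mem_cons_self)
      have := h3 v hv
      grind
    have hsubt : ∀ v ∈ t.dropLast, v = h ∨ v ∈ rest S x y a b A D := fun v hv => by
      have hvt := (hdt v).2 (Or.inl hv)
      have := hsub v (by simp [hvt]) fun h => hct (h ▸ hvt)
      have := h3 v
      grind
    rcases hgh with ⟨rfl, rfl⟩ | ⟨rfl, rfl⟩
    · have hP := h1.dropLast hsg (by grind)
      have hgd := notMem_dropLast h1.nodup hsg
      have hds : ∀ v, v ∈ s ↔ v ∈ s.dropLast ∨ v = g := fun v => by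
        conv_lhs => rw [← List.dropLast_append_getLast? g hsg]
        simp
      refine C.outcome_of_sides hw hcA hP hQ ?_ hsubt ?_ ?_ hd
      · intro v hv
        have := hsubs v ((hds v).2 (Or.inl hv))
        grind
      · grind
      · intro v hv
        have := hcov' v hv
        simp only [List.mem_append, List.mem_cons, hdt, hds] at this
        have := mem_rest.1 hv
        grind
    · right
      have hrev := h1.reverse hsg
      have hrx : s.reverse.getLast? = some x := h1.getLast?_reverse
      have hP := hrev.dropLast hrx (by grind)
      have hxd := notMem_dropLast hrev.nodup hrx
      have hds : ∀ v, v ∈ s ↔ v ∈ s.reverse.dropLast ∨ v = x := fun v => by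
        rw [← List.mem_reverse]
        conv_lhs => rw [← List.dropLast_append_getLast? x hrx]
        simp
      refine C.spanPair_of_ne hw hab (isPathFrom_of_gate hcA hQ hsubt)
        (isPathFrom_of_gate hcA hP ?_) ?_ ?_
      · intro v hv
        have := hsubs v ((hds v).2 (Or.inl hv))
        grind
      · grind
      · intro v hv
        have := hcov' v hv
        simp only [List.mem_append, List.mem_cons, hdt, hds] at this
        have := mem_rest.1 hv
        grind

/-- If all vertices outside of the two cuts are heavy, then there is a heavy path, a heavy pair of
paths or a spanning pair of paths. -/
theorem outcome [Finite V] (hw : IsWeight G w) (C : CutPair G S x y a b A D LA LD)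
    (hd : ∀ v ∈ rest S x y a b A D, d ≤ degreeIn w S v) :
    Heavy G w S x y d ∨ SpanPair G S x y := by
  obtain ⟨f1, f2, f3, f4, f5, f6, f7⟩ := C.facts
  obtain ⟨c, hcA⟩ := C.cutA.nonempty
  refine (heavyPath_or_hamPath (d := d) (isWeight_restrictWeight hw) (C.linked_gate hcA)
    ⟨a, mem_gateSet.2 (Or.inl ⟨f1.2.2.1, f3.2.2.1, f4.2.2.1⟩), f2.2.1, f2.2.2.1⟩ ?_).elim
    (fun h => Or.inl (C.heavy_of_gate hw hcA h)) (fun h => C.outcome_of_gate hw hcA h hd)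
  intro u hu v hv hux huy hvx hvy huv hadj
  by_cases hur : u ∈ rest S x y a b A D
  · left; rw [C.degreeIn_gate hw hur]; exact hd u hur
  by_cases hvr : v ∈ rest S x y a b A D
  · right; rw [C.degreeIn_gate hw hvr]; exact hd v hvr
  exfalso
  rw [mem_gateSet] at hu hv
  rw [mem_rest] at hur hvr
  rw [gateGraph_adj] at hadj
  simp only [Sym2.eq_iff] at hadj
  grind

end CutPair

end WGraph

namespace WGraph

section

variable {V : Type*} [DecidableEq V] {G : SimpleGraph V} {w : V → V → ℝ} {S : Finset V}
  {x y a b v : V} {d : ℝ} {l : List V} {A D : Finset V}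

lemma HamPath.exists_dropLast (h : HamPath G (insert x (insert a A)) x a) (hxa : x ≠ a)
    (haA : a ∉ A) :
    ∃ l, IsPathFrom G (insert x A) x l ∧ (∃ u, l.getLast? = some u ∧ G.Adj u a) ∧
      ∀ v ∈ A, v ∈ l := by
  obtain ⟨l, hl, hla, hc⟩ := h
  have hl' := List.dropLast_append_getLast? a hla
  have hd := hl.dropLast hla hxa
  have hal := notMem_dropLast hl.nodup hla
  obtain ⟨u, hu⟩ := hd.exists_getLast?
  refine ⟨l.dropLast, hd.mono fun v hv => ?_, ⟨u, hu, ?_⟩, fun v hv => ?_⟩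
  · have := hd.subset v hv
    grind
  · have h := hl.chain
    rw [← hl', List.isChain_append] at h
    exact h.2.2 u hu a rfl
  · have h := hc v (by simp [hv])
    rw [← hl', List.mem_append] at h
    grind

/-- The small side of a cut is traversed by a Hamiltonian path if there is a light vertex on the
other side. -/
lemma IsCut.hamPath (hw : IsWeight G w) (hL : Linked G S x y) (hA : IsCut G S x y a A)
    (hno : ¬ HeavyPath G w S x y d)
    (hd : ∀ p ∈ A, ∀ q ∈ A, p ≠ q → ¬ G.Adj p q → d ≤ degreeIn w S p ∨ d ≤ degreeIn w S q) :
    HamPath G (insert x (insert a A)) x a := by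
  refine (heavyPath_or_hamPath hw (hA.linked hL) ?_ ?_).resolve_left
    fun h => hno (hA.heavyPath hw hL h)
  · obtain ⟨v, hv⟩ := hA.nonempty
    exact ⟨v, by simp [hv], fun h => hA.left_notMem (h ▸ hv), fun h => hA.notMem (h ▸ hv)⟩
  · intro p hp q hq hpx hpa hqx hqa hpq hadj
    have hpA : p ∈ A := by simpa [hpx, hpa] using hp
    have hqA : q ∈ A := by simpa [hqx, hqa] using hq
    rw [hA.degreeIn_eq hw hL hpA, hA.degreeIn_eq hw hL hqA]
    exact hd p hpA q hqA hpq hadj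

/-- If among any three pairwise nonadjacent non-terminals one has weighted degree at least `d`,
there is a heavy path, a heavy pair of paths or a spanning pair of paths. -/
theorem heavy_or_spanPair [Finite V] (hw : IsWeight G w) (hL : Linked G S x y)
    (hd : ∀ p ∈ S, ∀ q ∈ S, ∀ r ∈ S, p ≠ x → p ≠ y → q ≠ x → q ≠ y → r ≠ x → r ≠ y →
      p ≠ q → p ≠ r → q ≠ r → ¬ G.Adj p q → ¬ G.Adj p r → ¬ G.Adj q r →
      d ≤ degreeIn w S p ∨ d ≤ degreeIn w S q ∨ d ≤ degreeIn w S r) :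
    Heavy G w S x y d ∨ SpanPair G S x y := by
  by_contra! hcon
  obtain ⟨hno, hnoS⟩ := hcon
  have hno' : ¬ Heavy G w S y x d := fun h => hno (h.symm hw)
  have hnoS' : ¬ SpanPair G S y x := fun h => hnoS h.symm
  induction hn : S.card using Nat.strong_induction_on generalizing S x y d with
  | _ n ih =>
  have step : ∀ x y, Linked G S x y →
      (∀ p ∈ S, ∀ q ∈ S, ∀ r ∈ S, p ≠ x → p ≠ y → q ≠ x → q ≠ y → r ≠ x → r ≠ y →
        p ≠ q → p ≠ r → q ≠ r → ¬ G.Adj p q → ¬ G.Adj p r → ¬ G.Adj q r →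
        d ≤ degreeIn w S p ∨ d ≤ degreeIn w S q ∨ d ≤ degreeIn w S r) →
      ¬ Heavy G w S x y d → ¬ SpanPair G S x y →
      ∃ x' ∈ S, x' ≠ x ∧ x' ≠ y ∧ G.Adj x x' ∧ ∃ a A, IsCut G S x y a A ∧ x' ∉ A := by
    clear! x y
    intro x y hL hd hno hnoS
    have hne : ∃ v ∈ S, v ≠ x ∧ v ≠ y := by
      by_contra! hcon
      refine hnoS ⟨[x], [y], IsPathFrom.singleton hL.left_mem, IsPathFrom.singleton hL.right_mem,
        by simpa using hL.ne, fun v hv => ?_⟩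
      have := hcon v hv
      simp only [List.mem_singleton]; tauto
    obtain ⟨x', hx', hxx', hyx', hadj, hmax⟩ := hL.exists_max_adj hw hne
    refine ⟨x', hx', hxx', hyx', hadj, (hL.erase_or_isCut hx' hxx' hyx').resolve_left
      fun hL' => ?_⟩
    have hno₂ : ¬ Heavy G w (S.erase x) x' y (d - w x x') :=
      fun h => hno (h.cons hadj hL.left_mem hL.ne)
    have hnoS₂ : ¬ SpanPair G (S.erase x) x' y := fun h => hnoS (h.cons hadj hL.left_mem)
    refine ih (S.erase x).card ?_ hL' ?_ hno₂ hnoS₂ (fun h => hno₂ (h.symm hw))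
      (fun h => hnoS₂ h.symm) rfl
    · rw [← hn]; exact Finset.card_erase_lt_of_mem hL.left_mem
    · intro p hp q hq r hr _ hpy _ hqy _ hry hpq hpr hqr h1 h2 h3
      simp only [Finset.mem_erase] at hp hq hr
      rw [degreeIn_erase hL.left_mem, degreeIn_erase hL.left_mem, degreeIn_erase hL.left_mem,
        hw.symm p x, hw.symm q x, hw.symm r x]
      have m1 := hmax p hp.2 hp.1 hpy
      have m2 := hmax q hq.2 hq.1 hqy
      have m3 := hmax r hr.2 hr.1 hry
      exact (hd p hp.2 q hq.2 r hr.2 hp.1 hpy hq.1 hqy hr.1 hry hpq hpr hqr h1 h2 h3).imp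
        (fun _ => by linarith) (Or.imp (fun _ => by linarith) (fun _ => by linarith))
  have hnoP : ¬ HeavyPath G w S x y d := fun h => hno (Or.inl h)
  have hnoP' : ¬ HeavyPath G w S y x d := fun h => hno' (Or.inl h)
  have int : ∀ {x y a A}, IsCut G S x y a A → ∀ v ∈ A, v ∈ S ∧ v ≠ x ∧ v ≠ y := fun h v hv =>
    ⟨h.subset hv, fun e => h.left_notMem (e ▸ hv), fun e => h.right_notMem (e ▸ hv)⟩
  -- Two sides without edges between them that both contain a light vertex have light cliques.
  have clique : ∀ A D : Finset V, (∀ v ∈ A, v ∈ S ∧ v ≠ x ∧ v ≠ y) →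
      (∀ v ∈ D, v ∈ S ∧ v ≠ x ∧ v ≠ y) → (∀ u ∈ A, ∀ v ∈ D, u ≠ v ∧ ¬ G.Adj u v) →
      (∃ v ∈ D, degreeIn w S v < d) → ∀ p ∈ A, ∀ q ∈ A, p ≠ q → ¬ G.Adj p q →
      d ≤ degreeIn w S p ∨ d ≤ degreeIn w S q := by
    intro A D hA hD hAD ⟨v, hv, hvl⟩ p hp q hq hpq hadj
    obtain ⟨p1, p2, p3⟩ := hA p hp
    obtain ⟨q1, q2, q3⟩ := hA q hq
    obtain ⟨v1, v2, v3⟩ := hD v hv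
    rcases hd p p1 q q1 v v1 p2 p3 q2 q3 v2 v3 hpq (hAD p hp v hv).1 (hAD q hq v hv).1 hadj
      (hAD p hp v hv).2 (hAD q hq v hv).2 with h | h | h
    exacts [Or.inl h, Or.inr h, absurd hvl (not_lt.2 h)]
  have nocut : ∀ R z, IsCut G S x y y R → z ∈ S → z ≠ x → z ≠ y → z ∉ R → False := by
    intro R z hR hz hzx hzy hzR
    have hR' := hR.compl hL hz hzx hzy hzR
    have hsep := fun u (hu : u ∈ R) v hv => not_adj_compl hR (u := u) (v := v) hu hv
    have h1 := hR.hamPath hw hL hnoP (clique _ _ (int hR) (int hR') hsep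
      (hR'.exists_light hw hL hnoP))
    have h2 := (hR'.swap hL).hamPath hw hL.symm hnoP' (clique _ _ (int hR') (int hR)
      (fun u hu v hv => ⟨(hsep v hv u hu).1.symm, fun h => (hsep v hv u hu).2 h.symm⟩)
      (hR.exists_light hw hL hnoP))
    obtain ⟨l, hl, -, hlc⟩ := h1.exists_dropLast hL.ne hR.notMem
    obtain ⟨m, hm, -, hmc⟩ := h2.exists_dropLast hL.ne.symm hR'.left_notMem
    have hxl := hl.head_mem
    have hym := hm.head_mem
    have hsub := hl.subset
    have hsub' := hm.subset
    have hxy := hL.ne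
    have hx := hL.left_mem
    have hy := hL.right_mem
    have hRS := hR.subset
    have hxR := hR.left_notMem
    have hyR := hR.right_notMem
    refine hnoS ⟨l, m, hl.mono (by grind), hm.mono (by grind), by grind, fun v hv => ?_⟩
    have := hlc v
    have := hmc v
    grind
  obtain ⟨x', hx', hxx', hyx', hadj, a, A, hA, hx'A⟩ := step x y hL hd hno hnoS
  obtain ⟨y', hy', hyy', hxy', -, b, D, hD, hy'D⟩ := step y x hL.symm
    (fun p hp q hq r hr h1 h2 h3 h4 h5 h6 => hd p hp q hq r hr h2 h1 h4 h3 h6 h5) hno' hnoS'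
  have hay : a ≠ y := by
    rintro rfl
    exact nocut A x' hA hx' hxx' hyx' hx'A
  have hbx : b ≠ x := by
    rintro rfl
    exact nocut D y' (hD.swap hL.symm) hy' hxy' hyy' hy'D
  rcases hA.crossing hL hD hay hbx hx' hxx' hyx' hadj hx'A with ⟨R, hR, haR⟩ | ⟨hdis, haD, hbA⟩
  · exact nocut R a hR hA.mem hA.ne hay haR
  have hsep : ∀ u ∈ A, ∀ v ∈ D, u ≠ v ∧ ¬ G.Adj u v := by
    intro u hu v hv
    have hvA : v ∉ A := Finset.disjoint_right.1 hdis hv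
    refine ⟨fun h => hvA (h ▸ hu), fun huv => ?_⟩
    rcases hA.closed u hu v (hD.subset hv) hvA huv with rfl | rfl
    · exact hD.right_notMem hv
    · exact haD hv
  have intD : ∀ v ∈ D, v ∈ S ∧ v ≠ x ∧ v ≠ y := fun v hv =>
    ⟨(int hD v hv).1, (int hD v hv).2.2, (int hD v hv).2.1⟩
  have lA := hA.exists_light hw hL hnoP
  have lD := hD.exists_light hw hL.symm hnoP'
  obtain ⟨LA, hLA, lastA, coverA⟩ := (hA.hamPath hw hL hnoP
    (clique _ _ (int hA) intD hsep lD)).exists_dropLast hA.ne.symm hA.notMem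
  obtain ⟨LD, hLD, lastD, coverD⟩ := (hD.hamPath hw hL.symm hnoP' (clique _ _ intD (int hA)
    (fun u hu v hv => ⟨(hsep v hv u hu).1.symm, fun h => (hsep v hv u hu).2 h.symm⟩)
    lA)).exists_dropLast hD.ne.symm hD.notMem
  have C : CutPair G S x y a b A D LA LD := ⟨hL, hA, hD, hdis, haD, hbA, hay, hbx, hLA, lastA,
    coverA, hLD, lastD, coverD⟩
  refine (C.outcome hw (d := d) fun v hv => ?_).elim hno hnoS
  rw [mem_rest] at hv
  obtain ⟨v1, v2, v3, v4, v5, v6, v7⟩ := hv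
  obtain ⟨p, hp, hpl⟩ := lA
  obtain ⟨q, hq, hql⟩ := lD
  obtain ⟨p1, p2, p3⟩ := int hA p hp
  obtain ⟨q1, q2, q3⟩ := intD q hq
  have hpv : ¬ G.Adj p v := fun h => by
    rcases hA.closed p hp v v1 v2 h with h | h
    exacts [v4 h, v6 h]
  have hqv : ¬ G.Adj q v := fun h => by
    rcases hD.closed q hq v v1 v3 h with h | h
    exacts [v5 h, v7 h]
  rcases hd p p1 q q1 v v1 p2 p3 q2 q3 v4 v5 (hsep p hp q hq).1 (fun h => v2 (h ▸ hp))
    (fun h => v3 (h ▸ hq)) (hsep p hp q hq).2 hpv hqv with h | h | h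
  exacts [absurd hpl (not_lt.2 h), absurd hql (not_lt.2 h), h]

end

section

variable {V : Type*} {G : SimpleGraph V} {x y : V}

open Classical in
/-- The weights of the edges of `G`, as a function of two vertices. -/
noncomputable def edgeWeight (G : SimpleGraph V) (w : Sym2 V → ℝ) (u v : V) : ℝ :=
  if G.Adj u v then w s(u, v) else 0

lemma isWeight_edgeWeight {w : Sym2 V → ℝ} (hw : ∀ e ∈ G.edgeSet, 0 ≤ w e) :
    IsWeight G (edgeWeight G w) where
  symm u v := by
    unfold edgeWeight
    rw [Sym2.eq_swap (a := u) (b := v)]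
    by_cases h : G.Adj u v <;> simp [h, G.adj_comm v u]
  nonneg u v := by
    unfold edgeWeight
    split_ifs with h
    exacts [hw _ h, le_rfl]
  eq_zero u v h := by simp [edgeWeight, h]

lemma degreeIn_edgeWeight [Fintype V] (w : Sym2 V → ℝ) (v : V) :
    degreeIn (edgeWeight G w) Finset.univ v = weightedDegree G w v := by
  classical
  rw [degreeIn, weightedDegree, Finset.sum_filter]
  exact Finset.sum_congr rfl fun u _ => by simp only [edgeWeight]

/-- A path given as a list of vertices is the support of a walk. -/
lemma IsPathFrom.exists_walk {S : Finset V} {l : List V} (w : Sym2 V → ℝ)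
    (h : IsPathFrom G S x l) :
    ∃ (b : V) (P : G.Walk x b), l.getLast? = some b ∧ P.IsPath ∧ P.support = l ∧
      walkWeight w P = listWeight (edgeWeight G w) l := by
  induction l generalizing x with
  | nil => exact absurd rfl h.ne_nil
  | cons c l ih =>
    obtain rfl : c = x := by simpa using h.head
    cases l with
    | nil => exact ⟨c, .nil, by simp [walkWeight]⟩
    | cons e l =>
      have hadj : G.Adj c e := h.chain.rel
      obtain ⟨b, P, h1, h2, h3, h4⟩ := ih (x := e) ⟨h.chain.of_cons, h.nodup.of_cons,
        fun v hv => h.subset v (List.mem_cons_of_mem _ hv), rfl⟩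
      refine ⟨b, .cons hadj P, by simpa using h1, ?_, by simp [h3], ?_⟩
      · rw [SimpleGraph.Walk.isPath_def]
        simpa [h3] using h.nodup
      · rw [listWeight_cons_cons, ← h4]
        simp [walkWeight, edgeWeight, hadj]

lemma IsTwoConnected.linked [Fintype V] (hG : IsTwoConnected G) (hxy : x ≠ y) :
    Linked G Finset.univ x y where
  left_mem := Finset.mem_univ x
  right_mem := Finset.mem_univ y
  ne := hxy
  expand X _ hne hx hy c := by
    obtain ⟨v, hv⟩ := hne
    obtain ⟨c', hc', hcc'⟩ : ∃ c', c' ∉ X ∧ (c ∉ X → c' = c) := by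
      by_cases h : c ∈ X
      · exact ⟨x, hx, fun h' => absurd h h'⟩
      · exact ⟨c, h, fun _ => rfl⟩
    obtain ⟨t, ht, htc⟩ : ∃ t, t ∉ X ∧ t ≠ c' := by
      by_cases h : x = c'
      · exact ⟨y, hy, fun h' => hxy (h.trans h'.symm)⟩
      · exact ⟨x, hx, h⟩
    have hvc : v ≠ c' := fun h => hc' (h ▸ hv)
    obtain ⟨p⟩ := (hG.connected_delete c').preconnected ⟨v, hvc⟩ ⟨t, htc⟩
    obtain ⟨e, -, h1, h2⟩ := p.exists_boundary_dart {u | u.1 ∈ X} hv ht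
    refine ⟨e.fst.1, h1, e.snd.1, Finset.mem_univ _, h2, fun h => ?_, e.adj⟩
    by_cases hc : c ∈ X
    · exact h2 (by simpa [h] using hc)
    · exact e.snd.2 (h.trans (hcc' hc).symm)

end

end WGraph

theorem theorem10 {V : Type*} [Fintype V] (G : SimpleGraph V) (w : Sym2 V → ℝ)
    (hw : ∀ e ∈ G.edgeSet, 0 ≤ w e) (hG : WGraph.IsTwoConnected G)
    (x y : V) (hxy : x ≠ y) (d : ℝ)
    (hd : ∀ v₁ v₂ v₃ : V,
      v₁ ≠ x → v₁ ≠ y → v₂ ≠ x → v₂ ≠ y → v₃ ≠ x → v₃ ≠ y →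
      v₁ ≠ v₂ → v₁ ≠ v₃ → v₂ ≠ v₃ →
      ¬ G.Adj v₁ v₂ → ¬ G.Adj v₁ v₃ → ¬ G.Adj v₂ v₃ →
      d ≤ max (WGraph.weightedDegree G w v₁)
        (max (WGraph.weightedDegree G w v₂) (WGraph.weightedDegree G w v₃))) :
    (∃ P : G.Walk x y, P.IsPath ∧ d ≤ WGraph.walkWeight w P) ∨
    (∃ (a b : V) (P₁ : G.Walk x a) (P₂ : G.Walk y b), P₁.IsPath ∧ P₂.IsPath ∧
      (∀ v : V, ¬ (v ∈ P₁.support ∧ v ∈ P₂.support)) ∧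
      d ≤ WGraph.walkWeight w P₁ + WGraph.walkWeight w P₂) ∨
    (∃ (a b : V) (P₁ : G.Walk x a) (P₂ : G.Walk y b), P₁.IsPath ∧ P₂.IsPath ∧
      (∀ v : V, ¬ (v ∈ P₁.support ∧ v ∈ P₂.support)) ∧
      (∀ v : V, v ∈ P₁.support ∨ v ∈ P₂.support)) := by
  classical
  have key := WGraph.heavy_or_spanPair (d := d) (WGraph.isWeight_edgeWeight hw) (hG.linked hxy)
    (by
      intro p _ q _ r _ p1 p2 q1 q2 r1 r2 h1 h2 h3 h4 h5 h6
      simpa only [WGraph.degreeIn_edgeWeight, le_max_iff] using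
        hd p q r p1 p2 q1 q2 r1 r2 h1 h2 h3 h4 h5 h6)
  rcases key with (⟨l, hl, hly, hwt⟩ | ⟨l, m, hl, hm, hdis, hwt⟩) | ⟨l, m, hl, hm, hdis, hc⟩
  · left
    obtain ⟨b, P, hb, hP, -, hPw⟩ := hl.exists_walk w
    obtain rfl : b = y := by simpa [hb] using hly
    exact ⟨P, hP, hPw ▸ hwt⟩
  · right; left
    obtain ⟨a, P, -, hP, rfl, hPw⟩ := hl.exists_walk w
    obtain ⟨b, Q, -, hQ, rfl, hQw⟩ := hm.exists_walk w
    exact ⟨a, b, P, Q, hP, hQ, fun v hv => hdis v hv.1 hv.2, by rwa [hPw, hQw]⟩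
  · right; right
    obtain ⟨a, P, -, hP, rfl, -⟩ := hl.exists_walk w
    obtain ⟨b, Q, -, hQ, rfl, -⟩ := hm.exists_walk w
    exact ⟨a, b, P, Q, hP, hQ, fun v hv => hdis v hv.1 hv.2, fun v => hc v (Finset.mem_univ v)⟩
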